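/- Let $d\ge 1$ and $n$ be integers. For vectors $x_1,\dots,x_n\in\mathbb R^d$ write $S_k=x_1+\dots+x_k$ $(1\le k\le n)$ and $S_n^*=x_1+\dots+x_{n-1}-x_n$. Let $\xi=(\xi_1,\dots,\xi_n)$ and $\xi'=(\xi_1',\dots,\xi_n')$ be tuples of random vectors in $\mathbb R^d$, possibly defined on different probability spaces, with partial sums $S_k$, $S_n^*$ and $S_k'$, $(S_n^*)'$ respectively. Consider the following three settings. - Type $A_{n-1}$: $n\ge d+1$, the tuple is exchangeable, i.e. $(\xi_1,\dots,\xi_n)\stackrel{d}{=}(\xi_{\sigma(1)},\dots,\xi_{\sigma(n)})$ for every permutation $\sigma$, and $S_n=0$ a.s. Put $H_{n,d}=\mathrm{Conv}(S_1,\dots,S_{n-1})$. General position: any $d$ random vectors among $S_1,\dots,S_{n-1}$ are linearly independent a.s. - Type $B_n$: $n\ge d$ and $(\xi_1,\dots,\xi_n)\stackrel{d}{=}(\varepsilon_1\xi_{\sigma(1)},\dots,\varepsilon_n\xi_{\sigma(n)})$ for every permutation $\sigma$ and all signs $\varepsilon_i\in\{-1,1\}$. Put $H_{n,d}=\mathrm{Conv}(S_1,\dots,S_n)$.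 General position: any $d$ random vectors among $S_1,\dots,S_n$ are linearly independent a.s. - Type $D_n$: $n\ge\max\{2,d\}$ and $(\xi_1,\dots,\xi_n)\stackrel{d}{=}(\varepsilon_1\xi_{\sigma(1)},\dots,\varepsilon_n\xi_{\sigma(n)})$ for every permutation $\sigma$ and all signs $\varepsilon_i\in\{-1,1\}$ with $\varepsilon_1\cdots\varepsilon_n=1$. Put $H_{n,d}=\mathrm{Conv}(S_1,\dots,S_{n-1},S_n,S_n^*)$. General position: any $d$ random vectors from either collection $S_1,\dots,S_n$ or $S_1,\dots,S_{n-1},S_n^*$ are linearly independent a.s. In each of the three settings, suppose that $\xi$ satisfies all the listed assumptions including general position, and that $\xi'$ satisfies the assumptions of the same setting except possibly general position; let $H'_{n,d}$ be the corresponding convex hull built from $\xi'$. Then $$\mathbb P[0\in\mathrm{Int}(H_{n,d}')]\le \mathbb P[0\in H_{n,d}]\le\mathbb P[0\in H_{n,d}'].$$ Moreover, $\mathbb P[0\in H_{n,d}]$ is distribution-free: it equals, in the respective cases $A_{n-1}$, $B_n$, $D_n$, $$\frac{2}{n!}\sum_{j\ge 0}{n\brack d+2+2j},\qquad \frac{2}{2^n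 n!}\sum_{j\ge 0}B(n,d+1+2j),\qquad \frac{2}{2^{n-1}n!}\sum_{j\ge 0}D(n,d+1+2j),$$ where ${n\brack k}$, $B(n,k)$, $D(n,k)$ are the coefficients of $t^k$ in the polynomials $t(t+1)\cdots(t+n-1)$, $(t+1)(t+3)\cdots(t+2n-1)$ and $(t+1)(t+3)\cdots(t+2n-3)(t+n-1)$, respectively (and are zero for $k>n$). -/

import Mathlib

open MeasureTheory ProbabilityTheory Polynomial

noncomputable section

/-- The `k`-th partial sum `x₁ + ⋯ + x_k` of an `n`-tuple (whose entries `x₁, …, x_n` are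
`x 0, …, x (n-1)`), for `k ≤ n`. -/
def partialSum {n : ℕ} {V : Type*} [AddCommGroup V] (x : Fin n → V) (k : ℕ) : V :=
  ∑ i : Fin n, if (i : ℕ) < k then x i else 0

/-- `S_n^* = x₁ + ⋯ + x_{n-1} - x_n`. -/
def starSum {n : ℕ} {V : Type*} [AddCommGroup V] (x : Fin n → V) : V :=
  ∑ i : Fin n, if (i : ℕ) + 1 < n then x i else -x i

/-- The list `S_1, …, S_{n-1}, S_n^*` as a function of the index `k ∈ {1, …, n}`. -/
def starredPartialSum {n : ℕ} {V : Type*} [AddCommGroup V] (x : Fin n → V) (k : ℕ) : V :=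
  if k < n then partialSum x k else starSum x

/-- Type `A_{n-1}`: `Conv(S_1, …, S_{n-1})`. -/
def hullA {n : ℕ} {V : Type*} [AddCommGroup V] [Module ℝ V] (x : Fin n → V) : Set V :=
  convexHull ℝ {v | ∃ k : ℕ, 1 ≤ k ∧ k < n ∧ v = partialSum x k}

/-- Type `B_n`: `Conv(S_1, …, S_n)`. -/
def hullB {n : ℕ} {V : Type*} [AddCommGroup V] [Module ℝ V] (x : Fin n → V) : Set V :=
  convexHull ℝ {v | ∃ k : ℕ, 1 ≤ k ∧ k ≤ n ∧ v = partialSum x k}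

/-- Type `D_n`: `Conv(S_1, …, S_{n-1}, S_n, S_n^*)`. -/
def hullD {n : ℕ} {V : Type*} [AddCommGroup V] [Module ℝ V] (x : Fin n → V) : Set V :=
  convexHull ℝ ({v | ∃ k : ℕ, 1 ≤ k ∧ k ≤ n ∧ v = partialSum x k} ∪ {starSum x})

section Settings

variable {n d : ℕ} {Ω : Type*} [MeasurableSpace Ω]

/-- The assumptions on the increments of type `A_{n-1}` (random walk bridges), without general
position: an exchangeable tuple of `n ≥ d + 1` random vectors with `S_n = 0` almost surely. -/
structure SettingA (P : Measure Ω) (ξ : Fin n → Ω → EuclideanSpace ℝ (Fin d)) : Prop where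
  le : d + 1 ≤ n
  measurable : ∀ i, Measurable (ξ i)
  exchangeable : ∀ σ : Equiv.Perm (Fin n),
    IdentDistrib (fun ω i => ξ i ω) (fun ω i => ξ (σ i) ω) P P
  bridge : ∀ᵐ ω ∂P, ∑ i, ξ i ω = 0

/-- The assumptions on the increments of type `B_n` (symmetric random walks), without general
position: a symmetrically exchangeable tuple of `n ≥ d` random vectors. -/
structure SettingB (P : Measure Ω) (ξ : Fin n → Ω → EuclideanSpace ℝ (Fin d)) : Prop where
  le : d ≤ n
  measurable : ∀ i, Measurable (ξ i)
  symmetric : ∀ (σ : Equiv.Perm (Fin n)) (ε : Fin n → ℤˣ),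
    IdentDistrib (fun ω i => ξ i ω) (fun ω i => ε i • ξ (σ i) ω) P P

/-- The assumptions on the increments of type `D_n`, without general position: a tuple of
`n ≥ max {2, d}` random vectors whose law is invariant under permutations and even numbers of
sign changes. -/
structure SettingD (P : Measure Ω) (ξ : Fin n → Ω → EuclideanSpace ℝ (Fin d)) : Prop where
  le : max 2 d ≤ n
  measurable : ∀ i, Measurable (ξ i)
  symmetric : ∀ (σ : Equiv.Perm (Fin n)) (ε : Fin n → ℤˣ), ∏ i, ε i = 1 →
    IdentDistrib (fun ω i => ξ i ω) (fun ω i => ε i • ξ (σ i) ω) P P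

/-- Any `d` vectors among `S_1, …, S_{n-1}` are linearly independent almost surely. -/
def GenPosA (P : Measure Ω) (ξ : Fin n → Ω → EuclideanSpace ℝ (Fin d)) : Prop :=
  ∀ k : Fin d → ℕ, StrictMono k → (∀ j, 1 ≤ k j ∧ k j < n) →
    ∀ᵐ ω ∂P, LinearIndependent ℝ fun j => partialSum (fun i => ξ i ω) (k j)

/-- Any `d` vectors among `S_1, …, S_n` are linearly independent almost surely. -/
def GenPosB (P : Measure Ω) (ξ : Fin n → Ω → EuclideanSpace ℝ (Fin d)) : Prop :=
  ∀ k : Fin d → ℕ, StrictMono k → (∀ j, 1 ≤ k j ∧ k j ≤ n) →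
    ∀ᵐ ω ∂P, LinearIndependent ℝ fun j => partialSum (fun i => ξ i ω) (k j)

/-- Any `d` vectors from either collection `S_1, …, S_n` or `S_1, …, S_{n-1}, S_n^*` are
linearly independent almost surely. -/
def GenPosD (P : Measure Ω) (ξ : Fin n → Ω → EuclideanSpace ℝ (Fin d)) : Prop :=
  ∀ k : Fin d → ℕ, StrictMono k → (∀ j, 1 ≤ k j ∧ k j ≤ n) →
    (∀ᵐ ω ∂P, LinearIndependent ℝ fun j => partialSum (fun i => ξ i ω) (k j)) ∧
    (∀ᵐ ω ∂P, LinearIndependent ℝ fun j => starredPartialSum (fun i => ξ i ω) (k j))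

end Settings

/-- `B(n, k)`: the coefficient of `t ^ k` in `(t + 1)(t + 3) ⋯ (t + 2n - 1)`. -/
def stirlingB (n k : ℕ) : ℕ :=
  (∏ i ∈ Finset.range n, ((X : ℕ[X]) + C (2 * i + 1))).coeff k

/-- `D(n, k)`: the coefficient of `t ^ k` in `(t + 1)(t + 3) ⋯ (t + 2n - 3)(t + n - 1)`
(used for `n ≥ 2`). -/
def stirlingD (n k : ℕ) : ℕ :=
  ((∏ i ∈ Finset.range (n - 1), ((X : ℕ[X]) + C (2 * i + 1))) * (X + C (n - 1))).coeff k

/-- `(2 / n!) ([n, d+2] + [n, d+4] + ⋯)` with the unsigned Stirling numbers of the first kind;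
the terms left out of the sum, here and in the next two definitions, vanish. -/
def valueA (n d : ℕ) : ℝ :=
  2 / (n.factorial : ℝ) * ∑ j ∈ Finset.range n, (Nat.stirlingFirst n (d + 2 + 2 * j) : ℝ)

/-- `(2 / (2^n n!)) (B(n, d+1) + B(n, d+3) + ⋯)`. -/
def valueB (n d : ℕ) : ℝ :=
  2 / (2 ^ n * (n.factorial : ℝ)) * ∑ j ∈ Finset.range n, (stirlingB n (d + 1 + 2 * j) : ℝ)

/-- `(2 / (2^(n-1) n!)) (D(n, d+1) + D(n, d+3) + ⋯)` (used for `n ≥ 2`). -/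
def valueD (n d : ℕ) : ℝ :=
  2 / (2 ^ (n - 1) * (n.factorial : ℝ)) * ∑ j ∈ Finset.range n, (stirlingD n (d + 1 + 2 * j) : ℝ)

end

/-! Let a finite group `G` act on tuples: permutations in type A, signed permutations in type B,
signed permutations with an even number of minus signs in type D. Invariance of the law turns `P[0 ∈
H]` into the expected number of `g ∈ G` with `0 ∈ H(g x)`, divided by `|G|`. The point is that this
number is a constant `N` as soon as the tuple `x` is in general position.

Summation by parts turns a relation `∑ w_k S_k = 0` with nonnegative weights into a relation `∑ u_i
x_i = 0` whose coefficients `u_i = ∑_{k > i} w_k` (with indices from 0) are weakly decreasing. In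
general position a nonnegative nonzero relation can be made strictly positive
(`SubsetsIndependent.exists_pos`), so `u` lies in an open Weyl chamber. Hence `N` counts the
chambers met by the space `relations x` of linear relations, which in type A is cut down to
coordinate sum zero. Equivalently, `N` counts the regions into which the reflection arrangement
dissects that space (`numRegions_eq_ncard`, `ncard_zero_mem_hullA`, `ncard_zero_mem_hullB`,
`ncard_zero_mem_hullD`).

General position of `x` makes this space meet the small flats of the arrangement only at zero
(`genericA_relations`, `genericB_relations`). For such subspaces deletion and restriction
(`numRegions_insert`) gives a recursion in `n` and `d` that matches the one for the coefficients of
the given polynomials (`GenericA.numRegions_eq`, `GenericB.numRegions_eq`). Type D is deduced from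
type B by removing the coordinate hyperplanes.

For a degenerate tuple `x'`, the perturbation `x' + ε z` with `z` in general position is in general
position for all small `ε ≠ 0`. The condition `0 ∈ H` is closed, and it is implied by the open
condition that no closed half-space through the origin contains all the points, which in turn
follows from `0 ∈ Int H`. Letting `ε → 0` bounds `N` on both sides (`ncard_bounds_of_eventually`),
and averaging over the group gives the inequalities (`absorption_probability_bounds`). -/

/-! ### Regions of a hyperplane arrangement on a subspace; deletion and restriction -/

section Regions

variable {E : Type*} [AddCommGroup E] [Module ℝ E]

/-- The points of `K` that lie on none of the hyperplanes `a = 0`, `a ∈ A`. -/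
def regularPoints (K : Submodule ℝ E) (A : Set (Module.Dual ℝ E)) : Set E :=
  {v | v ∈ K ∧ ∀ a ∈ A, a v ≠ 0}

/-- The functionals of `A` that are positive at `v`. -/
def signature (A : Set (Module.Dual ℝ E)) (v : E) : Set (Module.Dual ℝ E) :=
  {a | a ∈ A ∧ 0 < a v}

/-- The number of regions into which the hyperplanes `a = 0`, `a ∈ A`, dissect `K`. -/
noncomputable def numRegions (K : Submodule ℝ E) (A : Set (Module.Dual ℝ E)) : ℕ :=
  (signature A '' regularPoints K A).ncard

/-- Two labellings with the same fibres use equally many labels. This allows regions to be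
relabelled freely, by signatures of another arrangement or by chambers. -/
theorem ncard_image_eq_of_fibers {α β γ : Type*} {f : α → β} {g : α → γ} {s : Set α}
    (h : ∀ v ∈ s, ∀ w ∈ s, f v = f w ↔ g v = g w) : (f '' s).ncard = (g '' s).ncard := by
  classical
  have hex : ∀ b ∈ f '' s, ∃ v ∈ s, f v = b := fun b hb => hb
  choose r hr hfr using hex
  refine Set.ncard_congr (fun b hb => g (r b hb)) ?_ ?_ ?_
  · intro b hb
    exact ⟨r b hb, hr b hb, rfl⟩
  · intro b b' hb hb' e
    rw [← hfr b hb, ← hfr b' hb']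
    exact (h _ (hr b hb) _ (hr b' hb')).2 e
  · rintro _ ⟨v, hv, rfl⟩
    have hb : f v ∈ f '' s := ⟨v, hv, rfl⟩
    exact ⟨f v, hb, (h _ (hr _ hb) _ hv).1 (hfr _ hb)⟩

theorem signature_eq_iff {A : Set (Module.Dual ℝ E)} {v w : E} :
    signature A v = signature A w ↔ ∀ a ∈ A, (0 < a v ↔ 0 < a w) := by
  simp only [signature, Set.ext_iff, Set.mem_ofPred_eq]
  exact ⟨fun h a ha => by simpa [ha] using h a, fun h a => and_congr_right (h a)⟩

theorem finite_signatures {A : Set (Module.Dual ℝ E)} (hA : A.Finite) (s : Set E) :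
    (signature A '' s).Finite := by
  refine hA.powerset.subset ?_
  rintro _ ⟨v, -, rfl⟩ a ha
  exact ha.1

theorem numRegions_eq_zero {K : Submodule ℝ E} {A : Set (Module.Dual ℝ E)}
    {a : Module.Dual ℝ E} (ha : a ∈ A) (hK : ∀ v ∈ K, a v = 0) : numRegions K A = 0 := by
  have : regularPoints K A = ∅ := by
    ext v
    simp only [regularPoints, Set.mem_ofPred_eq, Set.mem_empty_iff_false, iff_false]
    rintro ⟨hv, h⟩
    exact h a ha (hK v hv)
  simp [numRegions, this]

theorem numRegions_empty (K : Submodule ℝ E) : numRegions K ∅ = 1 := by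
  have : signature (∅ : Set (Module.Dual ℝ E)) '' regularPoints K ∅ = {∅} := by
    ext s
    simp only [signature, regularPoints, Set.mem_image, Set.mem_singleton_iff]
    constructor
    · rintro ⟨v, -, rfl⟩
      simp
    · rintro rfl
      exact ⟨0, by simp, by simp⟩
  simp [numRegions, this]

/-- Each functional in `A` is on `K` a nonzero multiple of one in `B`. -/
def ProportionalOn (K : Submodule ℝ E) (A B : Set (Module.Dual ℝ E)) : Prop :=
  ∀ a ∈ A, ∃ b ∈ B, ∃ c : ℝ, c ≠ 0 ∧ ∀ v ∈ K, a v = c * b v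

theorem ProportionalOn.of_subset {K : Submodule ℝ E} {A B : Set (Module.Dual ℝ E)}
    (h : A ⊆ B) : ProportionalOn K A B :=
  fun a ha => ⟨a, h ha, 1, one_ne_zero, fun _ _ => (one_mul _).symm⟩

theorem ProportionalOn.regularPoints_subset {K : Submodule ℝ E} {A B : Set (Module.Dual ℝ E)}
    (h : ProportionalOn K A B) : regularPoints K B ⊆ regularPoints K A := by
  rintro v ⟨hv, hB⟩
  refine ⟨hv, fun a ha => ?_⟩
  obtain ⟨b, hb, c, hc, e⟩ := h a ha
  rw [e v hv]
  exact mul_ne_zero hc (hB b hb)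

theorem ProportionalOn.signature_eq {K : Submodule ℝ E} {A B : Set (Module.Dual ℝ E)}
    (h : ProportionalOn K A B) {v w : E} (hv : v ∈ regularPoints K B)
    (hw : w ∈ regularPoints K B) (e : signature B v = signature B w) :
    signature A v = signature A w := by
  rw [signature_eq_iff] at e ⊢
  intro a ha
  obtain ⟨b, hb, c, hc, hab⟩ := h a ha
  rw [hab v hv.1, hab w hw.1]
  have h1 := e b hb
  have hv0 := hv.2 b hb
  have hw0 := hw.2 b hb
  rcases hc.lt_or_gt with hc | hc
  · simp only [← smul_eq_mul]
    rw [smul_pos_iff_of_neg_left hc, smul_pos_iff_of_neg_left hc]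
    rw [← not_iff_not, not_lt, not_lt, hv0.symm.le_iff_lt, hw0.symm.le_iff_lt, h1]
  · rw [mul_pos_iff_of_pos_left hc, mul_pos_iff_of_pos_left hc, h1]

theorem numRegions_congr {K : Submodule ℝ E} {A B : Set (Module.Dual ℝ E)}
    (h : ProportionalOn K A B) (h' : ProportionalOn K B A) :
    numRegions K A = numRegions K B := by
  have e : regularPoints K A = regularPoints K B :=
    Set.Subset.antisymm h'.regularPoints_subset h.regularPoints_subset
  unfold numRegions
  rw [← e]
  refine ncard_image_eq_of_fibers fun v hv w hw => ⟨h'.signature_eq hv hw, ?_⟩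
  exact h.signature_eq (e ▸ hv) (e ▸ hw)

/-- A regular point stays in its region under a small perturbation. -/
theorem exists_small_perturbation {A : Set (Module.Dual ℝ E)} (hA : A.Finite) {v : E}
    (hv : ∀ a ∈ A, a v ≠ 0) (w : E) :
    ∃ t : ℝ, 0 < t ∧ ∀ a ∈ A, a (v + t • w) ≠ 0 ∧ (0 < a v ↔ 0 < a (v + t • w)) := by
  have key : ∀ a ∈ A, ∀ᶠ t : ℝ in nhds 0,
      a (v + t • w) ≠ 0 ∧ (0 < a v ↔ 0 < a (v + t • w)) := by
    intro a ha
    have hc : Continuous fun t : ℝ => a (v + t • w) := by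
      simp only [map_add, map_smul, smul_eq_mul]
      fun_prop
    have h0 : a (v + (0 : ℝ) • w) = a v := by simp
    rcases (hv a ha).lt_or_gt with h | h
    · have := hc.continuousAt.eventually_lt (continuousAt_const (y := (0 : ℝ))) (x₀ := 0)
        (by simpa using h)
      filter_upwards [this] with t ht
      exact ⟨ht.ne, by constructor <;> intro h' <;> linarith⟩
    · have := (continuousAt_const (y := (0 : ℝ))).eventually_lt hc.continuousAt (x₀ := 0)
        (by simpa using h)
      filter_upwards [this] with t ht
      exact ⟨ht.ne', by constructor <;> intro <;> assumption⟩
  have h2 := (hA.eventually_all (l := nhds (0 : ℝ))).2 key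
  have h3 : ∀ᶠ t : ℝ in nhdsWithin 0 (Set.Ioi 0),
      (∀ a ∈ A, a (v + t • w) ≠ 0 ∧ (0 < a v ↔ 0 < a (v + t • w))) ∧ 0 < t :=
    (h2.filter_mono nhdsWithin_le_nhds).and self_mem_nhdsWithin
  obtain ⟨t, h, ht⟩ := h3.exists
  exact ⟨t, ht, h⟩

/-- Deletion and restriction. -/
theorem numRegions_insert {K : Submodule ℝ E} {A : Set (Module.Dual ℝ E)} (hA : A.Finite)
    {h : Module.Dual ℝ E} (hh : ∃ v ∈ K, h v ≠ 0) :
    numRegions K (insert h A) = numRegions K A + numRegions (K ⊓ LinearMap.ker h) A := by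
  classical
  obtain ⟨w, hwK, hw⟩ : ∃ w ∈ K, 0 < h w := by
    obtain ⟨v, hv, h0⟩ := hh
    rcases h0.lt_or_gt with h1 | h1
    · exact ⟨-v, K.neg_mem hv, by simpa using h1⟩
    · exact ⟨v, hv, h1⟩
  -- An old region meets the new hyperplane exactly when it meets both of its open sides, that is
  -- `R0 = Rp ∩ Rn`. The claim is then `|Rp| + |Rn| = |Rp ∪ Rn| + |Rp ∩ Rn|`.
  let X := regularPoints K A
  let Rp := signature A '' {v | v ∈ X ∧ 0 < h v}
  let Rn := signature A '' {v | v ∈ X ∧ h v < 0}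
  let R0 := signature A '' {v | v ∈ X ∧ h v = 0}
  have f : ∀ s, (signature A '' s).Finite := finite_signatures hA
  have e0 : numRegions (K ⊓ LinearMap.ker h) A = R0.ncard := by
    unfold numRegions
    congr 2
    ext v
    simp only [regularPoints, Submodule.mem_inf, LinearMap.mem_ker, X, Set.mem_ofPred_eq]
    tauto
  have hp : R0 ⊆ Rp := by
    rintro _ ⟨v, ⟨⟨hv, hvA⟩, h0⟩, rfl⟩
    obtain ⟨t, ht, hs⟩ := exists_small_perturbation hA hvA w
    refine ⟨v + t • w, ⟨⟨K.add_mem hv (K.smul_mem t hwK), fun a ha => (hs a ha).1⟩, ?_⟩, ?_⟩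
    · simp [h0, ht, hw]
    · exact (signature_eq_iff.2 fun a ha => (hs a ha).2).symm
  have hn : R0 ⊆ Rn := by
    rintro _ ⟨v, ⟨⟨hv, hvA⟩, h0⟩, rfl⟩
    obtain ⟨t, ht, hs⟩ := exists_small_perturbation hA hvA (-w)
    refine ⟨v + t • (-w), ⟨⟨K.add_mem hv (K.smul_mem t (K.neg_mem hwK)),
      fun a ha => (hs a ha).1⟩, ?_⟩, ?_⟩
    · simp [h0, ht, hw]
    · exact (signature_eq_iff.2 fun a ha => (hs a ha).2).symm
  have hpn : Rp ∩ Rn ⊆ R0 := by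
    rintro _ ⟨⟨v, ⟨⟨hv, hvA⟩, h1⟩, rfl⟩, ⟨u, ⟨⟨hu, huA⟩, h2⟩, e⟩⟩
    rw [signature_eq_iff] at e
    -- Both coefficients are positive, so this combination stays in the common region of `v` and
    -- `u`; they are chosen so that `h` vanishes on it.
    have hpos : ∀ a ∈ A, (0 < a v → 0 < a ((-h u) • v + h v • u)) ∧
        (a v < 0 → a ((-h u) • v + h v • u) < 0) := by
      intro a ha
      simp only [map_add, map_smul, smul_eq_mul]
      refine ⟨fun hav => ?_, fun hav => ?_⟩
      · have := (e a ha).2 hav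
        have h3 := mul_pos (neg_pos.2 h2) hav
        have h4 := mul_pos h1 this
        linarith
      · have : a u < 0 := by
          rcases (huA a ha).lt_or_gt with h | h
          · exact h
          · exact absurd ((e a ha).1 h) hav.not_gt
        have h3 := mul_neg_of_pos_of_neg (neg_pos.2 h2) hav
        have h4 := mul_neg_of_pos_of_neg h1 this
        linarith
    refine ⟨(-h u) • v + h v • u, ⟨⟨K.add_mem (K.smul_mem _ hv) (K.smul_mem _ hu), ?_⟩, ?_⟩, ?_⟩
    · intro a ha
      rcases (hvA a ha).lt_or_gt with h | h
      · exact ((hpos a ha).2 h).ne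
      · exact ((hpos a ha).1 h).ne'
    · simp only [map_add, map_smul, smul_eq_mul]
      ring
    · refine signature_eq_iff.2 fun a ha => ?_
      rcases (hvA a ha).lt_or_gt with h | h
      · have := (hpos a ha).2 h
        constructor <;> intro <;> linarith
      · have := (hpos a ha).1 h
        constructor <;> intro <;> linarith
  have e1 : numRegions K A = (Rp ∪ Rn).ncard := by
    unfold numRegions
    congr 1
    ext s
    constructor
    · rintro ⟨v, hv, rfl⟩
      rcases lt_trichotomy (h v) 0 with h1 | h1 | h1
      · exact Or.inr ⟨v, ⟨hv, h1⟩, rfl⟩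
      · exact Or.inl (hp ⟨v, ⟨hv, h1⟩, rfl⟩)
      · exact Or.inl ⟨v, ⟨hv, h1⟩, rfl⟩
    · rintro (⟨v, ⟨hv, -⟩, rfl⟩ | ⟨v, ⟨hv, -⟩, rfl⟩)
      · exact ⟨v, hv, rfl⟩
      · exact ⟨v, hv, rfl⟩
  have e2 : numRegions K (insert h A) = Rp.ncard + Rn.ncard := by
    have hreg : regularPoints K (insert h A) = {v | v ∈ X ∧ 0 < h v} ∪ {v | v ∈ X ∧ h v < 0} := by
      ext v
      simp only [regularPoints, Set.mem_insert_iff, forall_eq_or_imp, X, Set.mem_union,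
        Set.mem_ofPred_eq, ← and_or_left, ne_iff_lt_or_gt (a := h v)]
      tauto
    unfold numRegions
    rw [hreg, Set.image_union, Set.ncard_union_eq ?_ (finite_signatures (hA.insert h) _)
      (finite_signatures (hA.insert h) _)]
    · congr 1
      · refine ncard_image_eq_of_fibers fun v hv u hu => ?_
        rw [signature_eq_iff, signature_eq_iff]
        simp [hv.2, hu.2]
      · refine ncard_image_eq_of_fibers fun v hv u hu => ?_
        rw [signature_eq_iff, signature_eq_iff]
        simp [hv.2.not_gt, hu.2.not_gt]
    · rw [Set.disjoint_left]
      rintro _ ⟨v, ⟨-, h1⟩, rfl⟩ ⟨u, ⟨-, h2⟩, e⟩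
      have := (signature_eq_iff.1 e h (Set.mem_insert _ _)).2 h1
      exact absurd this h2.not_gt
  have e3 : R0 = Rp ∩ Rn := Set.Subset.antisymm (Set.subset_inter hp hn) hpn
  rw [e0, e1, e2, e3, Set.ncard_union_add_ncard_inter _ _ (f _) (f _)]

/-- Adding the hyperplanes `l = m i`, any two of which meet inside a hyperplane of `A`. -/
theorem numRegions_union_image {ι : Type*} {K : Submodule ℝ E} {A : Set (Module.Dual ℝ E)}
    (hA : A.Finite) (l : Module.Dual ℝ E) (m : ι → Module.Dual ℝ E) (s : Finset ι)
    (hl : ∀ i ∈ s, ∃ v ∈ K, (l - m i) v ≠ 0)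
    (hm : ∀ i ∈ s, ∀ j ∈ s, i ≠ j → ∃ a ∈ A, ∃ c : ℝ, c ≠ 0 ∧ ∀ v, (m i - m j) v = c * a v) :
    numRegions K (A ∪ (fun i => l - m i) '' s) =
      numRegions K A + ∑ i ∈ s, numRegions (K ⊓ LinearMap.ker (l - m i)) A := by
  classical
  induction s using Finset.induction_on with
  | empty => simp
  | insert i s his ih =>
    have e : A ∪ (fun i => l - m i) '' ((insert i s : Finset ι) : Set ι) =
        insert (l - m i) (A ∪ (fun i => l - m i) '' s) := by
      rw [Finset.coe_insert, Set.image_insert_eq, Set.union_insert]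
    rw [e, numRegions_insert (hA.union (s.finite_toSet.image _)) (hl i (by simp)),
      ih (fun j hj => hl j (by simp [hj])) (fun j hj k hk => hm j (by simp [hj]) k (by simp [hk])),
      Finset.sum_insert his]
    -- On the hyperplane `l = m i` the functional `l - m j` equals `m i - m j`, a multiple of a
    -- member of `A`, so the hyperplanes added earlier cut nothing new.
    have e2 : numRegions (K ⊓ LinearMap.ker (l - m i)) (A ∪ (fun i => l - m i) '' s) =
        numRegions (K ⊓ LinearMap.ker (l - m i)) A := by
      refine numRegions_congr ?_ (ProportionalOn.of_subset Set.subset_union_left)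
      rintro a (ha | ⟨j, hj, rfl⟩)
      · exact ⟨a, ha, 1, one_ne_zero, fun _ _ => (one_mul _).symm⟩
      · have hij : i ≠ j := by
          rintro rfl
          exact his hj
        obtain ⟨a, ha, c, hc, h⟩ := hm i (by simp) j (by simp [Finset.mem_coe.1 hj]) hij
        refine ⟨a, ha, c, hc, fun v hv => ?_⟩
        rw [← h v]
        have := (LinearMap.mem_ker.1 hv.2)
        simp only [LinearMap.sub_apply] at this ⊢
        linarith
    rw [e2]
    ring

end Regions

/-! ### Recurrences and boundary values of the Stirling-type numbers -/

section Numbers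

/-- `2 ([n, d+2] + [n, d+4] + ⋯)`. -/
def regionCountA (n d : ℕ) : ℕ := 2 * ∑ j ∈ Finset.range n, Nat.stirlingFirst n (d + 2 + 2 * j)

/-- `2 (B(n, d+1) + B(n, d+3) + ⋯)`. -/
noncomputable def regionCountB (n d : ℕ) : ℕ :=
  2 * ∑ j ∈ Finset.range n, stirlingB n (d + 1 + 2 * j)

/-- `2 (D(n, d+1) + D(n, d+3) + ⋯)`. -/
noncomputable def regionCountD (n d : ℕ) : ℕ :=
  2 * ∑ j ∈ Finset.range n, stirlingD n (d + 1 + 2 * j)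

theorem stirlingB_succ_succ (n k : ℕ) :
    stirlingB (n + 1) (k + 1) = stirlingB n k + (2 * n + 1) * stirlingB n (k + 1) := by
  unfold stirlingB
  rw [Finset.prod_range_succ, mul_add, coeff_add, coeff_mul_X]
  simp only [coeff_mul_C]
  ring

theorem stirlingB_succ_zero (n : ℕ) :
    stirlingB (n + 1) 0 = (2 * n + 1) * stirlingB n 0 := by
  unfold stirlingB
  rw [Finset.prod_range_succ, mul_add, coeff_add, coeff_mul_X_zero]
  simp only [coeff_mul_C]
  ring

theorem stirlingB_zero (k : ℕ) : stirlingB 0 k = if k = 0 then 1 else 0 := by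
  simp [stirlingB, coeff_one]

theorem stirlingB_eq_zero_of_lt {n k : ℕ} (h : n < k) : stirlingB n k = 0 := by
  induction n generalizing k with
  | zero => rw [stirlingB_zero, if_neg (by omega)]
  | succ n ih =>
    obtain ⟨k, rfl⟩ : ∃ m, k = m + 1 := ⟨k - 1, by omega⟩
    rw [stirlingB_succ_succ, ih (by omega), ih (by omega), mul_zero, zero_add]

/-- The last factors satisfy `(X + n) + (n + 1) = X + (2n + 1)`. This is the numerical counterpart
of `numRegions_arrangementB_eq_add`. -/
theorem stirlingD_add (n k : ℕ) :
    stirlingD (n + 1) k + (n + 1) * stirlingB n k = stirlingB (n + 1) k := by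
  unfold stirlingD stirlingB
  rw [Finset.prod_range_succ, Nat.add_sub_cancel, mul_add, mul_add, coeff_add, coeff_add]
  simp only [coeff_mul_C]
  ring

theorem regionCountB_succ_succ (n d : ℕ) :
    regionCountB (n + 1) (d + 1) =
      regionCountB n d + (2 * n + 1) * regionCountB n (d + 1) := by
  unfold regionCountB
  have h : ∀ j, stirlingB (n + 1) (d + 1 + 1 + 2 * j) =
      stirlingB n (d + 1 + 2 * j) + (2 * n + 1) * stirlingB n (d + 1 + 1 + 2 * j) := by
    intro j
    rw [show d + 1 + 1 + 2 * j = d + 1 + 2 * j + 1 by ring, stirlingB_succ_succ]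
  simp only [h, Finset.sum_add_distrib, ← Finset.mul_sum]
  rw [Finset.sum_range_succ, Finset.sum_range_succ, stirlingB_eq_zero_of_lt (n := n) (by omega),
    stirlingB_eq_zero_of_lt (n := n) (by omega)]
  ring

theorem regionCountB_eq_zero {n d : ℕ} (h : n ≤ d) : regionCountB n d = 0 := by
  unfold regionCountB
  rw [Finset.sum_eq_zero fun j _ => stirlingB_eq_zero_of_lt (by omega), mul_zero]

/-- The polynomial vanishes at `-1` and equals `2 ^ (n + 1) * (n + 1)!` at `1`, so the even and the
odd coefficients each sum to half of that value. The recurrence exchanges the parities, which is why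
both sums are carried through one induction; `M` is left free because the shift of the index
shortens the range. -/
theorem sum_stirlingB_even_odd (n : ℕ) : ∀ M, n + 1 ≤ M →
    ∑ j ∈ Finset.range M, stirlingB (n + 1) (2 * j) = 2 ^ n * (n + 1).factorial ∧
    ∑ j ∈ Finset.range M, stirlingB (n + 1) (2 * j + 1) = 2 ^ n * (n + 1).factorial := by
  induction n with
  | zero =>
    rintro (_ | M) hM
    · omega
    · simp only [Finset.sum_range_succ', stirlingB_succ_succ,
        stirlingB_succ_zero, stirlingB_zero, mul_add, mul_zero]
      simp
  | succ n ih =>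
    rintro (_ | M) hM
    · omega
    obtain ⟨h1, h2⟩ := ih (M + 1) (by omega)
    have h3 := (ih M (by omega)).2
    constructor
    · rw [Finset.sum_range_succ']
      have : ∀ j, stirlingB (n + 1 + 1) (2 * (j + 1)) =
          stirlingB (n + 1) (2 * j + 1) + (2 * (n + 1) + 1) * stirlingB (n + 1) (2 * (j + 1)) :=
        fun j => stirlingB_succ_succ (n + 1) (2 * j + 1)
      simp only [this, Finset.sum_add_distrib, ← Finset.mul_sum, mul_zero, stirlingB_succ_zero (n + 1)]
      rw [Finset.sum_range_succ', mul_zero] at h1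
      rw [h3, add_assoc, ← mul_add, h1, Nat.factorial_succ (n + 1)]
      ring
    · simp only [stirlingB_succ_succ (n + 1), Finset.sum_add_distrib, ← Finset.mul_sum]
      rw [h1, h2, Nat.factorial_succ (n + 1)]
      ring

theorem regionCountB_zero_right {n : ℕ} (hn : 0 < n) :
    regionCountB n 0 = 2 ^ n * n.factorial := by
  obtain ⟨n, rfl⟩ : ∃ m, n = m + 1 := ⟨n - 1, by omega⟩
  unfold regionCountB
  simp only [zero_add, add_comm 1]
  rw [(sum_stirlingB_even_odd n (n + 1) le_rfl).2]
  ring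

theorem regionCountA_succ_succ (n d : ℕ) :
    regionCountA (n + 1) (d + 1) =
      regionCountA n d + n * regionCountA n (d + 1) := by
  unfold regionCountA
  have h : ∀ j, Nat.stirlingFirst (n + 1) (d + 1 + 2 + 2 * j) =
      Nat.stirlingFirst n (d + 2 + 2 * j) + n * Nat.stirlingFirst n (d + 1 + 2 + 2 * j) := by
    intro j
    rw [add_comm (Nat.stirlingFirst n _), show d + 1 + 2 + 2 * j = d + 2 + 2 * j + 1 by ring,
      ← Nat.stirlingFirst_succ_succ]
  simp only [h, Finset.sum_add_distrib, ← Finset.mul_sum]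
  rw [Finset.sum_range_succ, Finset.sum_range_succ,
    Nat.stirlingFirst_eq_zero_of_lt (n := n) (by omega),
    Nat.stirlingFirst_eq_zero_of_lt (n := n) (by omega)]
  ring

theorem regionCountA_eq_zero {n d : ℕ} (h : n ≤ d + 1) : regionCountA n d = 0 := by
  unfold regionCountA
  rw [Finset.sum_eq_zero fun j _ => Nat.stirlingFirst_eq_zero_of_lt (by omega), mul_zero]

/-- The rising factorial of degree `n + 2` vanishes at `-1` and equals `(n + 2)!` at `1`; its
constant term is zero, so the even sum may start at index 2. -/
theorem sum_stirlingFirst_even_odd (n : ℕ) : ∀ M, n + 1 ≤ M →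
    2 * ∑ j ∈ Finset.range M, Nat.stirlingFirst (n + 2) (2 * j + 2) = (n + 2).factorial ∧
    2 * ∑ j ∈ Finset.range M, Nat.stirlingFirst (n + 2) (2 * j + 1) = (n + 2).factorial := by
  induction n with
  | zero =>
    rintro (_ | M) hM
    · omega
    · simp only [Finset.sum_range_succ', mul_add]
      simp [Nat.stirlingFirst]
  | succ n ih =>
    rintro (_ | M) hM
    · omega
    obtain ⟨h1, h2⟩ := ih (M + 1) (by omega)
    have h3 := (ih M (by omega)).1
    constructor
    · simp only [show ∀ j, Nat.stirlingFirst (n + 1 + 2) (2 * j + 2) = _ from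
        fun j => Nat.stirlingFirst_succ_succ (n + 2) (2 * j + 1), Finset.sum_add_distrib,
        ← Finset.mul_sum]
      rw [mul_add, h2, mul_left_comm, h1, Nat.factorial_succ (n + 2)]
      ring
    · simp only [show ∀ j, Nat.stirlingFirst (n + 1 + 2) (2 * j + 1) = _ from
        fun j => Nat.stirlingFirst_succ_succ (n + 2) (2 * j), Finset.sum_add_distrib,
        ← Finset.mul_sum]
      rw [Finset.sum_range_succ' (fun j => Nat.stirlingFirst (n + 2) (2 * j)), mul_zero,
        Nat.stirlingFirst_succ_zero, add_zero, mul_add, mul_left_comm, h2]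
      rw [show ∑ j ∈ Finset.range M, Nat.stirlingFirst (n + 2) (2 * (j + 1)) =
        ∑ j ∈ Finset.range M, Nat.stirlingFirst (n + 2) (2 * j + 2) from rfl, h3,
        Nat.factorial_succ (n + 2)]
      ring

theorem regionCountA_zero_right {n : ℕ} (hn : 2 ≤ n) : regionCountA n 0 = n.factorial := by
  obtain ⟨n, rfl⟩ : ∃ m, n = m + 2 := ⟨n - 2, by omega⟩
  unfold regionCountA
  simp only [zero_add, add_comm 2]
  rw [(sum_stirlingFirst_even_odd n (n + 2) (by omega)).1]

theorem regionCountD_add (n d : ℕ) :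
    regionCountD (n + 1) d + (n + 1) * regionCountB n d = regionCountB (n + 1) d := by
  unfold regionCountD regionCountB
  have : ∑ j ∈ Finset.range n, stirlingB n (d + 1 + 2 * j) =
      ∑ j ∈ Finset.range (n + 1), stirlingB n (d + 1 + 2 * j) := by
    rw [Finset.sum_range_succ, stirlingB_eq_zero_of_lt (n := n) (by omega), add_zero]
  rw [this, mul_left_comm, Finset.mul_sum (a := n + 1), ← mul_add, ← Finset.sum_add_distrib]
  simp only [stirlingD_add]

end Numbers

/-! ### The reflection arrangements of types A, B and D -/

section Arrangements

variable {E : Type*} [AddCommGroup E] [Module ℝ E] {n d : ℕ}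

/-- The functionals `l i - l j`. -/
def arrangementA (l : Fin n → Module.Dual ℝ E) : Set (Module.Dual ℝ E) :=
  {a | ∃ i j, i ≠ j ∧ a = l i - l j}

/-- The functionals `l i - l j` and `l i + l j`. -/
def arrangementD (l : Fin n → Module.Dual ℝ E) : Set (Module.Dual ℝ E) :=
  {a | ∃ i j, i ≠ j ∧ (a = l i - l j ∨ a = l i + l j)}

/-- The functionals `l i`, `l i - l j` and `l i + l j`. -/
def arrangementB (l : Fin n → Module.Dual ℝ E) : Set (Module.Dual ℝ E) :=
  Set.range l ∪ arrangementD l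

theorem finite_arrangementA (l : Fin n → Module.Dual ℝ E) : (arrangementA l).Finite := by
  refine (Set.finite_range fun p : Fin n × Fin n => l p.1 - l p.2).subset ?_
  rintro _ ⟨i, j, -, rfl⟩
  exact ⟨(i, j), rfl⟩

theorem finite_arrangementD (l : Fin n → Module.Dual ℝ E) : (arrangementD l).Finite := by
  refine ((Set.finite_range fun p : Fin n × Fin n => l p.1 - l p.2).union
    (Set.finite_range fun p : Fin n × Fin n => l p.1 + l p.2)).subset ?_
  rintro _ ⟨i, j, -, rfl | rfl⟩
  · exact Or.inl ⟨(i, j), rfl⟩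
  · exact Or.inr ⟨(i, j), rfl⟩

theorem finite_arrangementB (l : Fin n → Module.Dual ℝ E) : (arrangementB l).Finite :=
  (Set.finite_range l).union (finite_arrangementD l)

/-- The hyperplanes that involve the index 0 are `l 0 = l i.succ`, and two of them meet inside `l
i.succ = l j.succ`, which belongs to the smaller arrangement. -/
theorem numRegions_arrangementA_succ (K : Submodule ℝ E) (l : Fin (n + 1) → Module.Dual ℝ E)
    (h : ∀ i : Fin n, ∃ v ∈ K, (l 0 - l i.succ) v ≠ 0) :
    numRegions K (arrangementA l) = numRegions K (arrangementA fun i : Fin n => l i.succ) +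
      ∑ i : Fin n, numRegions (K ⊓ LinearMap.ker (l 0 - l i.succ))
        (arrangementA fun i : Fin n => l i.succ) := by
  rw [← numRegions_union_image (finite_arrangementA _) (l 0) (fun i : Fin n => l i.succ)
    Finset.univ (fun i _ => h i)]
  · refine numRegions_congr ?_ (ProportionalOn.of_subset ?_)
    · rintro _ ⟨i, j, hij, rfl⟩
      cases i using Fin.cases with
      | zero =>
        cases j using Fin.cases with
        | zero => exact absurd rfl hij
        | succ j => exact ⟨_, Or.inr ⟨j, by simp, rfl⟩, 1, one_ne_zero, by simp⟩
      | succ i =>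
        cases j using Fin.cases with
        | zero => exact ⟨_, Or.inr ⟨i, by simp, rfl⟩, -1, by simp, by simp⟩
        | succ j =>
          exact ⟨_, Or.inl ⟨i, j, fun e => hij (e ▸ rfl), rfl⟩, 1, one_ne_zero, by simp⟩
    · rintro _ (⟨i, j, hij, rfl⟩ | ⟨i, -, rfl⟩)
      · exact ⟨i.succ, j.succ, by simpa using hij, rfl⟩
      · exact ⟨0, i.succ, (Fin.succ_ne_zero i).symm, rfl⟩
  · intro i _ j _ hij
    exact ⟨_, ⟨i, j, hij, rfl⟩, 1, one_ne_zero, by simp⟩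

/-- The `2n + 1` hyperplanes that involve the index 0 are `l 0 = m` with `m` one of `0`, `l i.succ`,
`-l i.succ`. The difference of two such `m` is proportional to a member of the smaller arrangement;
opposite signs of one index give `± 2 l i.succ`. -/
theorem numRegions_arrangementB_succ (K : Submodule ℝ E) (l : Fin (n + 1) → Module.Dual ℝ E)
    (h0 : ∃ v ∈ K, l 0 v ≠ 0)
    (h1 : ∀ i : Fin n, ∃ v ∈ K, (l 0 - l i.succ) v ≠ 0)
    (h2 : ∀ i : Fin n, ∃ v ∈ K, (l 0 + l i.succ) v ≠ 0) :
    numRegions K (arrangementB l) = numRegions K (arrangementB fun i : Fin n => l i.succ) +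
      (numRegions (K ⊓ LinearMap.ker (l 0)) (arrangementB fun i : Fin n => l i.succ) +
      (∑ i : Fin n, numRegions (K ⊓ LinearMap.ker (l 0 - l i.succ))
        (arrangementB fun i : Fin n => l i.succ) +
      ∑ i : Fin n, numRegions (K ⊓ LinearMap.ker (l 0 + l i.succ))
        (arrangementB fun i : Fin n => l i.succ))) := by
  have key := numRegions_union_image (K := K)
    (finite_arrangementB fun i : Fin n => l i.succ) (l 0)
    (Sum.elim (fun _ : Unit => 0) (Sum.elim (fun i : Fin n => l i.succ) fun i : Fin n => -l i.succ))
    Finset.univ (by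
      rintro (i | i | i) -
      · simpa using h0
      · simpa using h1 i
      · simpa using h2 i) (by
      rintro (i | i | i) - (j | j | j) - hij
      · exact absurd rfl hij
      · exact ⟨_, Or.inl (Set.mem_range_self j), -1, by simp, by simp⟩
      · exact ⟨_, Or.inl (Set.mem_range_self j), 1, by simp, by simp⟩
      · exact ⟨_, Or.inl (Set.mem_range_self i), 1, by simp, by simp⟩
      · exact ⟨_, Or.inr ⟨i, j, by simpa using hij, Or.inl rfl⟩, 1, by simp, by simp⟩
      · by_cases e : i = j
        · subst e
          exact ⟨_, Or.inl (Set.mem_range_self i), 2, by simp, fun v => by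
            simp
            ring⟩
        · exact ⟨_, Or.inr ⟨i, j, e, Or.inr rfl⟩, 1, by simp, by simp⟩
      · exact ⟨_, Or.inl (Set.mem_range_self i), -1, by simp, by simp⟩
      · by_cases e : i = j
        · subst e
          exact ⟨_, Or.inl (Set.mem_range_self i), -2, by simp, fun v => by
            simp
            ring⟩
        · exact ⟨_, Or.inr ⟨i, j, e, Or.inr rfl⟩, -1, by simp, fun v => by simp; ring⟩
      · exact ⟨_, Or.inr ⟨i, j, by simpa using hij, Or.inl rfl⟩, -1, by simp,
          fun v => by simp [neg_add_eq_sub]⟩)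
  simp only [Fintype.sum_sum_type, Finset.univ_unique, Sum.elim_inl, Sum.elim_inr,
    Finset.sum_singleton, sub_zero, sub_neg_eq_add] at key
  rw [← key]
  refine numRegions_congr ?_ (ProportionalOn.of_subset ?_)
  · have hmem : ∀ i, l 0 - Sum.elim (fun _ : Unit => 0)
        (Sum.elim (fun i : Fin n => l i.succ) fun i : Fin n => -l i.succ) i ∈
        (arrangementB fun i : Fin n => l i.succ) ∪ (fun i => l 0 - Sum.elim (fun _ : Unit => 0)
        (Sum.elim (fun i : Fin n => l i.succ) fun i : Fin n => -l i.succ) i) ''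
          ((Finset.univ : Finset (Unit ⊕ Fin n ⊕ Fin n)) : Set (Unit ⊕ Fin n ⊕ Fin n)) :=
      fun i => Or.inr ⟨i, by simp, rfl⟩
    rintro _ (⟨i, rfl⟩ | ⟨i, j, hij, rfl | rfl⟩)
    · cases i using Fin.cases with
      | zero => exact ⟨_, hmem (Sum.inl ()), 1, by simp, by simp⟩
      | succ i => exact ⟨_, Or.inl (Or.inl ⟨i, rfl⟩), 1, by simp, by simp⟩
    · cases i using Fin.cases with
      | zero =>
        cases j using Fin.cases with
        | zero => exact absurd rfl hij
        | succ j => exact ⟨_, hmem (Sum.inr (Sum.inl j)), 1, by simp, by simp⟩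
      | succ i =>
        cases j using Fin.cases with
        | zero => exact ⟨_, hmem (Sum.inr (Sum.inl i)), -1, by simp, by simp⟩
        | succ j =>
          exact ⟨_, Or.inl (Or.inr ⟨i, j, fun e => hij (e ▸ rfl), Or.inl rfl⟩), 1, by simp,
            by simp⟩
    · cases i using Fin.cases with
      | zero =>
        cases j using Fin.cases with
        | zero => exact absurd rfl hij
        | succ j => exact ⟨_, hmem (Sum.inr (Sum.inr j)), 1, by simp, by simp⟩
      | succ i =>
        cases j using Fin.cases with
        | zero => exact ⟨_, hmem (Sum.inr (Sum.inr i)), 1, by simp, by simp [add_comm]⟩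
        | succ j =>
          exact ⟨_, Or.inl (Or.inr ⟨i, j, fun e => hij (e ▸ rfl), Or.inr rfl⟩), 1, by simp,
            by simp⟩
  · have hne : ∀ i : Fin n, (0 : Fin (n + 1)) ≠ i.succ := fun i => (Fin.succ_ne_zero i).symm
    rintro _ ((⟨i, rfl⟩ | ⟨i, j, hij, rfl | rfl⟩) | ⟨i | i | i, -, rfl⟩)
    · exact Or.inl ⟨_, rfl⟩
    · exact Or.inr ⟨_, _, by simpa using hij, Or.inl rfl⟩
    · exact Or.inr ⟨_, _, by simpa using hij, Or.inr rfl⟩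
    · exact Or.inl ⟨0, by simp⟩
    · exact Or.inr ⟨0, i.succ, hne i, Or.inl (by simp)⟩
    · exact Or.inr ⟨0, i.succ, hne i, Or.inr (by simp)⟩

end Arrangements

/-! ### Region counts for subspaces in general position -/

section GeneralPosition

variable {E : Type*} [AddCommGroup E] [Module ℝ E] {n d : ℕ}

/-- `K` is in general position, and of codimension at most `d`, with respect to the hyperplanes
`l i = l j`, modulo the line on which all `l i` agree. -/
def GenericA (K : Submodule ℝ E) (l : Fin n → Module.Dual ℝ E) (d : ℕ) : Prop :=
  n ≤ Module.finrank ℝ K + d + 1 ∧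
    ∀ v ∈ K, v ≠ 0 → d + 1 < (Finset.univ.image fun i => l i v).card

/-- `K` is in general position, and of codimension at most `d`, with respect to the hyperplanes
`l i = 0` and `l i = ± l j`. -/
def GenericB (K : Submodule ℝ E) (l : Fin n → Module.Dual ℝ E) (d : ℕ) : Prop :=
  n ≤ Module.finrank ℝ K + d ∧
    ∀ v ∈ K, v ≠ 0 → d < ((Finset.univ.image fun i => |l i v|).erase 0).card

theorem finrank_le_finrank_inf_ker [FiniteDimensional ℝ E]
    (K : Submodule ℝ E) (h : Module.Dual ℝ E) :
    Module.finrank ℝ K ≤ Module.finrank ℝ (K ⊓ LinearMap.ker h : Submodule ℝ E) + 1 := by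
  have h1 := Submodule.finrank_sup_add_finrank_inf_eq K (LinearMap.ker h)
  have h2 := LinearMap.finrank_range_add_finrank_ker h
  have h3 := Submodule.finrank_le (LinearMap.range h)
  have h4 := Submodule.finrank_le (K ⊔ LinearMap.ker h)
  rw [Module.finrank_self] at h3
  omega

theorem exists_ne_zero_of_lt_finrank [FiniteDimensional ℝ E]
    {K : Submodule ℝ E} {k : ℕ} (f : Fin k → Module.Dual ℝ E)
    (hk : k < Module.finrank ℝ K) : ∃ v ∈ K, v ≠ 0 ∧ ∀ i, f i v = 0 := by
  have := LinearMap.ker_ne_bot_of_finrank_lt (f := (LinearMap.pi f).domRestrict K) (by simpa)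
  obtain ⟨v, hv, hv0⟩ := Submodule.exists_mem_ne_zero_of_ne_bot this
  refine ⟨v, v.2, by simpa using hv0, fun i => ?_⟩
  simpa using congrFun (LinearMap.mem_ker.1 hv) i

theorem exists_mem_eq_of_forall_ne_zero [FiniteDimensional ℝ E]
    {K : Submodule ℝ E} {k : ℕ} (f : Fin k → Module.Dual ℝ E)
    (hk : k ≤ Module.finrank ℝ K) (hf : ∀ v ∈ K, v ≠ 0 → ∃ i, f i v ≠ 0) (u : Fin k → ℝ) :
    ∃ v ∈ K, ∀ i, f i v = u i := by
  let F := (LinearMap.pi f).domRestrict K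
  have hinj : Function.Injective F := by
    rw [← LinearMap.ker_eq_bot, LinearMap.ker_eq_bot']
    intro v hv
    by_contra hv0
    obtain ⟨i, hi⟩ := hf v v.2 (by simpa using hv0)
    exact hi (by simpa [F] using congrFun hv i)
  have hle := LinearMap.finrank_le_finrank_of_injective hinj
  have heq : Module.finrank ℝ K = Module.finrank ℝ (Fin k → ℝ) := by
    apply le_antisymm hle
    simpa using hk
  obtain ⟨v, hv⟩ := (LinearMap.injective_iff_surjective_of_finrank_eq_finrank heq).1 hinj u
  exact ⟨v, v.2, fun i => by simpa [F] using congrFun hv i⟩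

theorem GenericB.eq_zero_of_le {K : Submodule ℝ E} {l : Fin n → Module.Dual ℝ E}
    (h : GenericB K l d) (hd : n ≤ d) : ∀ v ∈ K, v = 0 := by
  intro v hv
  by_contra h0
  have h1 := h.2 v hv h0
  have h2 := (Finset.card_le_card (Finset.erase_subset 0 _)).trans
    (Finset.card_image_le (s := Finset.univ) (f := fun i => |l i v|))
  rw [Finset.card_univ, Fintype.card_fin] at h2
  omega

theorem GenericA.eq_zero_of_le {K : Submodule ℝ E} {l : Fin n → Module.Dual ℝ E}
    (h : GenericA K l d) (hd : n ≤ d + 1) : ∀ v ∈ K, v = 0 := by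
  intro v hv
  by_contra h0
  have h1 := h.2 v hv h0
  have h2 := (Finset.card_image_le (s := Finset.univ) (f := fun i => l i v))
  rw [Finset.card_univ, Fintype.card_fin] at h2
  omega

/-- Forgetting one functional loses at most one absolute value, so `n` and `d` drop together. This
is the deletion half of the recursion. -/
theorem GenericB.tail {K : Submodule ℝ E} {l : Fin (n + 1) → Module.Dual ℝ E}
    (h : GenericB K l (d + 1)) : GenericB K (fun i : Fin n => l i.succ) d := by
  refine ⟨by have := h.1; omega, fun v hv h0 => ?_⟩
  have h1 := h.2 v hv h0
  have h2 : (Finset.univ.image fun i => |l i v|).erase 0 ⊆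
      insert |l 0 v| ((Finset.univ.image fun i : Fin n => |l i.succ v|).erase 0) := by
    intro x
    simp only [Finset.mem_erase, Finset.mem_image, Finset.mem_univ, true_and, Fin.exists_fin_succ,
      Finset.mem_insert]
    grind
  have h3 := (Finset.card_le_card h2).trans (Finset.card_insert_le _ _)
  exact Nat.lt_of_succ_lt_succ (h1.trans_le h3)

theorem GenericA.tail {K : Submodule ℝ E} {l : Fin (n + 1) → Module.Dual ℝ E}
    (h : GenericA K l (d + 1)) : GenericA K (fun i : Fin n => l i.succ) d := by
  refine ⟨by have := h.1; omega, fun v hv h0 => ?_⟩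
  have h1 := h.2 v hv h0
  have h2 : (Finset.univ.image fun i => l i v) ⊆
      insert (l 0 v) (Finset.univ.image fun i : Fin n => l i.succ v) := by
    intro x
    simp only [Finset.mem_image, Finset.mem_univ, true_and, Fin.exists_fin_succ,
      Finset.mem_insert]
    grind
  have h3 := (Finset.card_le_card h2).trans (Finset.card_insert_le _ _)
  exact Nat.lt_of_succ_lt_succ (h1.trans_le h3)

theorem erase_image_abs_subset {l : Fin (n + 1) → Module.Dual ℝ E} (p : Fin (n + 1)) {v : E}
    (hv : l p v = 0 ∨ ∃ j : Fin n, |l p v| = |l (p.succAbove j) v|) :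
    (Finset.univ.image fun i => |l i v|).erase 0 ⊆
      (Finset.univ.image fun i : Fin n => |l (p.succAbove i) v|).erase 0 := by
  intro x
  simp only [Finset.mem_erase, Finset.mem_image, Finset.mem_univ, true_and,
    Fin.exists_iff_succAbove p]
  rintro ⟨hx, h | h⟩
  · rcases hv with h' | ⟨j, hj⟩
    · exact absurd (by simpa [h'] using h.symm) hx
    · exact ⟨hx, j, by rw [← hj, h]⟩
  · exact ⟨hx, h⟩

/-- On the hyperplane the value of `l p` is zero or repeats another one up to sign, so forgetting it
loses no nonzero absolute value. The dimension and `n` both drop by at most one, and `d` stays: the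
restriction half of the recursion. -/
theorem GenericB.restrict [FiniteDimensional ℝ E]
    {K : Submodule ℝ E} {l : Fin (n + 1) → Module.Dual ℝ E}
    (hK : GenericB K l d) (p : Fin (n + 1)) (h : Module.Dual ℝ E)
    (hh : ∀ v, h v = 0 → l p v = 0 ∨ ∃ j : Fin n, |l p v| = |l (p.succAbove j) v|) :
    GenericB (K ⊓ LinearMap.ker h) (fun i : Fin n => l (p.succAbove i)) d := by
  refine ⟨?_, fun v hv h0 => ?_⟩
  · have h1 := hK.1
    have h2 := finrank_le_finrank_inf_ker K h
    omega
  · exact (hK.2 v hv.1 h0).trans_le (Finset.card_le_card (erase_image_abs_subset p (hh v hv.2)))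

/-- If `h` vanished on `K`, the functional `l p` would contribute no new nonzero absolute value.
Since `dim K > n - d`, another `n - d` of the functionals can be killed at a nonzero vector of `K`,
which leaves at most `d` nonzero absolute values and contradicts genericity. -/
theorem GenericB.exists_apply_ne_zero [FiniteDimensional ℝ E]
    {K : Submodule ℝ E} {l : Fin (n + 1) → Module.Dual ℝ E}
    (hK : GenericB K l d) (hd : d ≤ n) (p : Fin (n + 1)) (h : Module.Dual ℝ E)
    (hh : ∀ v, h v = 0 → l p v = 0 ∨ ∃ j : Fin n, |l p v| = |l (p.succAbove j) v|) :
    ∃ v ∈ K, h v ≠ 0 := by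
  by_contra! hcon
  obtain ⟨k, rfl⟩ := Nat.exists_eq_add_of_le' hd
  obtain ⟨v, hv, hv0, hz⟩ := exists_ne_zero_of_lt_finrank (K := K)
    (fun i : Fin k => l (p.succAbove (Fin.castAdd d i))) (by have := hK.1; omega)
  have h1 := hK.2 v hv hv0
  have h2 := Finset.card_le_card (erase_image_abs_subset p (hh v (hcon v hv)))
  have h3 : (Finset.univ.image fun i : Fin (k + d) => |l (p.succAbove i) v|).erase 0 ⊆
      Finset.univ.image fun i : Fin d => |l (p.succAbove (Fin.natAdd k i)) v| := by
    intro x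
    simp only [Finset.mem_erase, Finset.mem_image, Finset.mem_univ, true_and]
    rintro ⟨hx, i, rfl⟩
    cases i using Fin.addCases with
    | left i => simp [hz i] at hx
    | right i => exact ⟨i, rfl⟩
  have h4 := (Finset.card_le_card h3).trans Finset.card_image_le
  rw [Finset.card_univ, Fintype.card_fin] at h4
  omega

theorem image_subset_of_eq {l : Fin (n + 1) → Module.Dual ℝ E} (j : Fin n) {v : E}
    (hv : (l 0 - l j.succ) v = 0) :
    (Finset.univ.image fun i => l i v) ⊆ Finset.univ.image fun i : Fin n => l i.succ v := by
  intro x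
  simp only [Finset.mem_image, Finset.mem_univ, true_and, Fin.exists_fin_succ]
  rintro (rfl | h)
  · exact ⟨j, (sub_eq_zero.1 hv).symm⟩
  · exact h

theorem GenericA.restrict [FiniteDimensional ℝ E]
    {K : Submodule ℝ E} {l : Fin (n + 1) → Module.Dual ℝ E}
    (hK : GenericA K l d) (j : Fin n) :
    GenericA (K ⊓ LinearMap.ker (l 0 - l j.succ)) (fun i : Fin n => l i.succ) d := by
  refine ⟨?_, fun v hv h0 => ?_⟩
  · have h1 := hK.1
    have h2 := finrank_le_finrank_inf_ker K (l 0 - l j.succ)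
    omega
  · exact (hK.2 v hv.1 h0).trans_le (Finset.card_le_card (image_subset_of_eq j hv.2))

/-- As in type B, except that functionals are made equal to a common one instead of zero, which
leaves at most `d + 1` distinct values. -/
theorem GenericA.exists_apply_ne_zero [FiniteDimensional ℝ E]
    {K : Submodule ℝ E} {l : Fin (n + 1) → Module.Dual ℝ E}
    (hK : GenericA K l d) (hd : d + 1 ≤ n) (j : Fin n) :
    ∃ v ∈ K, (l 0 - l j.succ) v ≠ 0 := by
  by_contra! hcon
  obtain ⟨k, rfl⟩ := Nat.exists_eq_add_of_le' hd
  obtain ⟨v, hv, hv0, hz⟩ := exists_ne_zero_of_lt_finrank (K := K)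
    (fun i : Fin k => l (Fin.castAdd (d + 1) i).succ - l (Fin.natAdd k (0 : Fin (d + 1))).succ)
    (by have := hK.1; omega)
  have h1 := hK.2 v hv hv0
  have h2 := Finset.card_le_card (image_subset_of_eq j (hcon v hv))
  have h3 : (Finset.univ.image fun i : Fin (k + (d + 1)) => l i.succ v) ⊆
      Finset.univ.image fun i : Fin (d + 1) => l (Fin.natAdd k i).succ v := by
    intro x
    simp only [Finset.mem_image, Finset.mem_univ, true_and]
    rintro ⟨i, rfl⟩
    cases i using Fin.addCases with
    | left i => exact ⟨0, (sub_eq_zero.1 (hz i)).symm⟩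
    | right i => exact ⟨i, rfl⟩
  have h4 := (Finset.card_le_card h3).trans Finset.card_image_le
  rw [Finset.card_univ, Fintype.card_fin] at h4
  omega

/-- The start `d = 0` of the recursion, where `d` cannot be lowered further: `K` is cut like the
whole space. Prescribing the value of `l 0` shows that the hypothesis survives each restriction, so
the count grows by the factor `1 + (2n + 1)`. -/
theorem numRegions_arrangementB_of_surjective {K : Submodule ℝ E} {l : Fin n → Module.Dual ℝ E}
    (h : ∀ u : Fin n → ℝ, ∃ v ∈ K, ∀ i, l i v = u i) :
    numRegions K (arrangementB l) = 2 ^ n * n.factorial := by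
  induction n generalizing K with
  | zero =>
    have : arrangementB l = ∅ := by
      ext a
      simp [arrangementB, arrangementD]
    rw [this, numRegions_empty]
    rfl
  | succ n ih =>
    have hcons : ∀ (a : ℝ) (u : Fin n → ℝ), ∃ v ∈ K, l 0 v = a ∧ ∀ i : Fin n, l i.succ v = u i := by
      intro a u
      obtain ⟨v, hv, e⟩ := h (Fin.cons a u)
      exact ⟨v, hv, e 0, fun i => e i.succ⟩
    rw [numRegions_arrangementB_succ, ih, ih]
    · rw [Finset.sum_congr rfl fun i _ => ih _, Finset.sum_congr rfl fun i _ => ih _]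
      · simp [Nat.factorial_succ]
        ring
      · intro i _ u
        obtain ⟨v, hv, e0, e⟩ := hcons (-u i) u
        exact ⟨v, ⟨hv, by simp [e0, e]⟩, e⟩
      · intro i _ u
        obtain ⟨v, hv, e0, e⟩ := hcons (u i) u
        exact ⟨v, ⟨hv, by simp [e0, e]⟩, e⟩
    · intro u
      obtain ⟨v, hv, e0, e⟩ := hcons 0 u
      exact ⟨v, ⟨hv, by simp [e0]⟩, e⟩
    · intro u
      obtain ⟨v, hv, e0, e⟩ := hcons 0 u
      exact ⟨v, hv, e⟩
    · obtain ⟨v, hv, e0, e⟩ := hcons 1 0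
      exact ⟨v, hv, by simp [e0]⟩
    · intro i
      obtain ⟨v, hv, e0, e⟩ := hcons 1 0
      exact ⟨v, hv, by simp [e0, e]⟩
    · intro i
      obtain ⟨v, hv, e0, e⟩ := hcons 1 0
      exact ⟨v, hv, by simp [e0, e]⟩

/-- The analogue for type A. The functionals enter only through differences, so their values need to
be prescribed only up to a common constant. -/
theorem numRegions_arrangementA_of_surjective {K : Submodule ℝ E} {l : Fin n → Module.Dual ℝ E}
    (h : ∀ u : Fin n → ℝ, ∃ v ∈ K, ∃ c : ℝ, ∀ i, l i v = u i + c) :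
    numRegions K (arrangementA l) = n.factorial := by
  induction n generalizing K with
  | zero =>
    have : arrangementA l = ∅ := by
      ext a
      simp [arrangementA]
    rw [this, numRegions_empty]
    rfl
  | succ n ih =>
    have hcons : ∀ (a : ℝ) (u : Fin n → ℝ), ∃ v ∈ K, ∃ c : ℝ, l 0 v = a + c ∧
        ∀ i : Fin n, l i.succ v = u i + c := by
      intro a u
      obtain ⟨v, hv, c, e⟩ := h (Fin.cons a u)
      exact ⟨v, hv, c, e 0, fun i => e i.succ⟩
    rw [numRegions_arrangementA_succ, ih]
    · rw [Finset.sum_congr rfl fun i _ => ih _]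
      · simp [Nat.factorial_succ]
        ring
      · intro i _ u
        obtain ⟨v, hv, c, e0, e⟩ := hcons (u i) u
        exact ⟨v, ⟨hv, by simp [e0, e]⟩, c, e⟩
    · intro u
      obtain ⟨v, hv, c, e0, e⟩ := hcons 0 u
      exact ⟨v, hv, c, e⟩
    · intro i
      obtain ⟨v, hv, c, e0, e⟩ := hcons 1 0
      exact ⟨v, hv, by simp [e0, e]⟩

theorem GenericB.numRegions_eq [FiniteDimensional ℝ E]
    {K : Submodule ℝ E} {l : Fin n → Module.Dual ℝ E}
    (hK : GenericB K l d) (hn : 0 < n) :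
    numRegions K (arrangementB l) = regionCountB n d := by
  induction n generalizing K d with
  | zero => omega
  | succ n ih =>
    rcases le_or_gt (n + 1) d with hd | hd
    · have h0 := hK.eq_zero_of_le hd
      rw [regionCountB_eq_zero hd]
      exact numRegions_eq_zero (Or.inl ⟨0, rfl⟩) fun v hv => by rw [h0 v hv, map_zero]
    rcases d with _ | d
    · rw [regionCountB_zero_right hn]
      apply numRegions_arrangementB_of_surjective
      refine exists_mem_eq_of_forall_ne_zero l hK.1 fun v hv h0 => ?_
      obtain ⟨x, hx⟩ := Finset.card_pos.1 (hK.2 v hv h0)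
      simp only [Finset.mem_erase, Finset.mem_image, Finset.mem_univ, true_and] at hx
      obtain ⟨hx, i, rfl⟩ := hx
      exact ⟨i, abs_ne_zero.1 hx⟩
    · have e0 : ∀ v, l 0 v = 0 → l 0 v = 0 ∨
          ∃ j : Fin n, |l 0 v| = |l ((0 : Fin (n + 1)).succAbove j) v| := fun v hv => Or.inl hv
      have e1 : ∀ (i : Fin n) v, (l 0 - l i.succ) v = 0 → l 0 v = 0 ∨
          ∃ j : Fin n, |l 0 v| = |l ((0 : Fin (n + 1)).succAbove j) v| := fun i v hv =>
        Or.inr ⟨i, by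
          rw [LinearMap.sub_apply, sub_eq_zero] at hv
          simp [hv]⟩
      have e2 : ∀ (i : Fin n) v, (l 0 + l i.succ) v = 0 → l 0 v = 0 ∨
          ∃ j : Fin n, |l 0 v| = |l ((0 : Fin (n + 1)).succAbove j) v| := fun i v hv =>
        Or.inr ⟨i, by
          rw [LinearMap.add_apply, add_eq_zero_iff_eq_neg] at hv
          simp [hv]⟩
      have r : ∀ h : Module.Dual ℝ E, (∀ v, h v = 0 → l 0 v = 0 ∨
          ∃ j : Fin n, |l 0 v| = |l ((0 : Fin (n + 1)).succAbove j) v|) →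
          numRegions (K ⊓ LinearMap.ker h) (arrangementB fun i : Fin n => l i.succ) =
            regionCountB n (d + 1) := fun h hh => ih (hK.restrict 0 h hh) (by omega)
      rw [numRegions_arrangementB_succ K l (hK.exists_apply_ne_zero (by omega) 0 _ e0)
        (fun i => hK.exists_apply_ne_zero (by omega) 0 _ (e1 i))
        (fun i => hK.exists_apply_ne_zero (by omega) 0 _ (e2 i)), ih hK.tail (by omega), r _ e0,
        Finset.sum_congr rfl fun i _ => r _ (e1 i), Finset.sum_congr rfl fun i _ => r _ (e2 i),
        regionCountB_succ_succ]
      simp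
      ring

theorem GenericA.numRegions_eq [FiniteDimensional ℝ E]
    {K : Submodule ℝ E} {l : Fin n → Module.Dual ℝ E}
    (hK : GenericA K l d) (hn : 2 ≤ n) :
    numRegions K (arrangementA l) = regionCountA n d := by
  induction n generalizing K d with
  | zero => omega
  | succ n ih =>
    rcases le_or_gt (n + 1) (d + 1) with hd | hd
    · have h0 := hK.eq_zero_of_le hd
      rw [regionCountA_eq_zero hd]
      exact numRegions_eq_zero ⟨0, ⟨1, by omega⟩, by simp [Fin.ext_iff], rfl⟩
        fun v hv => by rw [h0 v hv, map_zero]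
    rcases d with _ | d
    · rw [regionCountA_zero_right hn]
      apply numRegions_arrangementA_of_surjective
      -- For `d = 0` a nonzero vector of `K` takes at least two values, so the `n` differences from
      -- `l 0` have no common nonzero zero in `K`; as `dim K ≥ n`, they can be prescribed.
      have h1 := exists_mem_eq_of_forall_ne_zero (K := K) (fun i : Fin n => l i.succ - l 0)
        (by have := hK.1; omega) fun v hv h0 => by
          by_contra! hcon
          have h2 := hK.2 v hv h0
          have h3 : (Finset.univ.image fun i => l i v) ⊆ {l 0 v} := by
            intro x
            simp only [Finset.mem_image, Finset.mem_univ, true_and, Fin.exists_fin_succ,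
              Finset.mem_singleton]
            rintro (rfl | ⟨i, rfl⟩)
            · rfl
            · simpa [sub_eq_zero] using hcon i
          have h4 := Finset.card_le_card h3
          simp only [Finset.card_singleton] at h4
          omega
      intro u
      obtain ⟨v, hv, e⟩ := h1 fun i => u i.succ - u 0
      refine ⟨v, hv, l 0 v - u 0, fun i => ?_⟩
      cases i using Fin.cases with
      | zero => ring
      | succ i =>
        have := e i
        rw [LinearMap.sub_apply] at this
        linarith
    · rw [numRegions_arrangementA_succ K l (hK.exists_apply_ne_zero (by omega)),
        ih hK.tail (by omega),
        Finset.sum_congr rfl fun i _ => ih (hK.restrict i) (by omega),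
        regionCountA_succ_succ]
      simp

/-- Passing from the arrangement of type `D` to that of type `B`. -/
theorem numRegions_arrangementB_eq_add (K : Submodule ℝ E) (l : Fin (n + 1) → Module.Dual ℝ E)
    (h : ∀ i, ∃ v ∈ K, l i v ≠ 0) :
    numRegions K (arrangementB l) = numRegions K (arrangementD l) +
      ∑ i, numRegions (K ⊓ LinearMap.ker (l i))
        (arrangementB fun j : Fin n => l (i.succAbove j)) := by
  have key : ∀ s : Finset (Fin (n + 1)), numRegions K (arrangementD l ∪ l '' s) =
      numRegions K (arrangementD l) + ∑ i ∈ s, numRegions (K ⊓ LinearMap.ker (l i))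
        (arrangementB fun j : Fin n => l (i.succAbove j)) := by
    intro s
    induction s using Finset.induction_on with
    | empty => simp
    | insert i s his ih =>
      rw [Finset.coe_insert, Set.image_insert_eq, Set.union_insert, numRegions_insert
        ((finite_arrangementD l).union (s.finite_toSet.image _)) (h i), ih,
        Finset.sum_insert his]
      -- On `l i = 0` the functionals `l i ± l k` reduce to `± l k`. They supply all the coordinate
      -- hyperplanes of the type B arrangement in the remaining indices, whatever `s` is.
      have : numRegions (K ⊓ LinearMap.ker (l i)) (arrangementD l ∪ l '' s) =
          numRegions (K ⊓ LinearMap.ker (l i))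
            (arrangementB fun j : Fin n => l (i.succAbove j)) := by
        apply numRegions_congr
        · rintro _ (⟨j, k, hjk, rfl | rfl⟩ | ⟨j, hj, rfl⟩)
          · rcases Fin.eq_self_or_eq_succAbove i j with rfl | ⟨j, rfl⟩
            · obtain ⟨k, rfl⟩ := Fin.exists_succAbove_eq hjk.symm
              refine ⟨_, Or.inl ⟨k, rfl⟩, -1, by simp, fun v hv => ?_⟩
              have := LinearMap.mem_ker.1 hv.2
              simp [this]
            · rcases Fin.eq_self_or_eq_succAbove i k with rfl | ⟨k, rfl⟩
              · refine ⟨_, Or.inl ⟨j, rfl⟩, 1, by simp, fun v hv => ?_⟩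
                have := LinearMap.mem_ker.1 hv.2
                simp [this]
              · exact ⟨_, Or.inr ⟨j, k, fun e => hjk (e ▸ rfl), Or.inl rfl⟩, 1, by simp, by simp⟩
          · rcases Fin.eq_self_or_eq_succAbove i j with rfl | ⟨j, rfl⟩
            · obtain ⟨k, rfl⟩ := Fin.exists_succAbove_eq hjk.symm
              refine ⟨_, Or.inl ⟨k, rfl⟩, 1, by simp, fun v hv => ?_⟩
              have := LinearMap.mem_ker.1 hv.2
              simp [this]
            · rcases Fin.eq_self_or_eq_succAbove i k with rfl | ⟨k, rfl⟩
              · refine ⟨_, Or.inl ⟨j, rfl⟩, 1, by simp, fun v hv => ?_⟩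
                have := LinearMap.mem_ker.1 hv.2
                simp [this]
              · exact ⟨_, Or.inr ⟨j, k, fun e => hjk (e ▸ rfl), Or.inr rfl⟩, 1, by simp, by simp⟩
          · have hji : j ≠ i := by
              rintro rfl
              exact his hj
            obtain ⟨k, rfl⟩ := Fin.exists_succAbove_eq hji
            exact ⟨_, Or.inl ⟨k, rfl⟩, 1, by simp, by simp⟩
        · rintro _ (⟨j, rfl⟩ | ⟨j, k, hjk, rfl | rfl⟩)
          · refine ⟨_, Or.inl ⟨i.succAbove j, i, Fin.succAbove_ne i j, Or.inl rfl⟩, 1, by simp,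
              fun v hv => ?_⟩
            have := LinearMap.mem_ker.1 hv.2
            simp [this]
          · exact ⟨_, Or.inl ⟨i.succAbove j, i.succAbove k, by simpa using hjk, Or.inl rfl⟩, 1,
              by simp, by simp⟩
          · exact ⟨_, Or.inl ⟨i.succAbove j, i.succAbove k, by simpa using hjk, Or.inr rfl⟩, 1,
              by simp, by simp⟩
      rw [this]
      ring
  have := key Finset.univ
  rwa [Finset.coe_univ, Set.image_univ, Set.union_comm] at this

theorem GenericB.numRegions_arrangementD_eq [FiniteDimensional ℝ E]
    {K : Submodule ℝ E} {l : Fin n → Module.Dual ℝ E}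
    (hK : GenericB K l d) (hn : 2 ≤ n) :
    numRegions K (arrangementD l) = regionCountD n d := by
  obtain ⟨n, rfl⟩ : ∃ m, n = m + 1 := ⟨n - 1, by omega⟩
  have hD := regionCountD_add n d
  rcases le_or_gt (n + 1) d with hd | hd
  · have h0 := hK.eq_zero_of_le hd
    rw [regionCountB_eq_zero hd] at hD
    rw [numRegions_eq_zero (A := arrangementD l) (a := l 0 - l ⟨1, by omega⟩)
        ⟨0, ⟨1, by omega⟩, by simp [Fin.ext_iff], Or.inl rfl⟩
        fun v hv => by rw [h0 v hv, map_zero]]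
    omega
  · have h1 := numRegions_arrangementB_eq_add K l
      fun i => hK.exists_apply_ne_zero (by omega) i (l i) fun v hv => Or.inl hv
    rw [hK.numRegions_eq (by omega), Finset.sum_congr rfl fun i _ =>
      (hK.restrict i (l i) fun v hv => Or.inl hv).numRegions_eq (by omega)] at h1
    simp only [Finset.sum_const, Finset.card_univ, Fintype.card_fin, smul_eq_mul] at h1
    omega

end GeneralPosition

/-! ### Weyl chambers as labels of regions -/

section Chambers

/-- Counting regions by the chambers that they lie in. -/
theorem numRegions_eq_ncard {E γ : Type*} [AddCommGroup E] [Module ℝ E] {K : Submodule ℝ E}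
    {A : Set (Module.Dual ℝ E)} (p : γ → Prop) (C : γ → E → Prop)
    (walls : γ → Set (Module.Dual ℝ E)) (hC : ∀ g v, C g v ↔ ∀ b ∈ walls g, 0 < b v)
    (hwalls : ∀ g, ∀ b ∈ walls g, b ∈ A ∨ -b ∈ A)
    (hreg : ∀ g v, p g → C g v → ∀ a ∈ A, a v ≠ 0)
    (hex : ∀ v, (∀ a ∈ A, a v ≠ 0) → ∃ g, p g ∧ C g v)
    (huniq : ∀ g g' v, p g → p g' → C g v → C g' v → g = g') :
    numRegions K A = {g | p g ∧ ∃ v ∈ K, C g v}.ncard := by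
  have e : numRegions K A = ((fun v => {g | p g ∧ C g v}) '' regularPoints K A).ncard := by
    refine ncard_image_eq_of_fibers fun v hv w hw => ?_
    rw [signature_eq_iff]
    constructor
    · have key : ∀ v w : E, (∀ a ∈ A, a v ≠ 0) → (∀ a ∈ A, a w ≠ 0) →
          (∀ a ∈ A, (0 < a v ↔ 0 < a w)) → ∀ g, C g v → C g w := by
        intro v w hv hw h g hg
        rw [hC] at hg ⊢
        intro b hb
        rcases hwalls g b hb with h1 | h1
        · exact (h b h1).1 (hg b hb)
        · have h2 := hg b hb
          have h3 := (h _ h1).not.1 (by simpa using h2.le)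
          have h4 := hw _ h1
          simp only [LinearMap.neg_apply, Left.neg_pos_iff, not_lt] at h3
          rw [LinearMap.neg_apply, neg_ne_zero] at h4
          exact lt_of_le_of_ne h3 h4.symm
      intro h
      ext g
      exact and_congr_right fun _ => ⟨key v w hv.2 hw.2 h g,
        key w v hw.2 hv.2 (fun a ha => (h a ha).symm) g⟩
    · intro h a ha
      obtain ⟨g, hp, hg⟩ := hex v hv.2
      have hg' : C g w := by
        have : g ∈ {g | p g ∧ C g v} := ⟨hp, hg⟩
        rw [h] at this
        exact this.2
      by_contra hne
      have hneg : a v * a w < 0 := by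
        rcases (hv.2 a ha).lt_or_gt with h1 | h1 <;> rcases (hw.2 a ha).lt_or_gt with h2 | h2
        · exact absurd (iff_of_false h1.not_gt h2.not_gt) hne
        · exact mul_neg_of_neg_of_pos h1 h2
        · exact mul_neg_of_pos_of_neg h1 h2
        · exact absurd (iff_of_true h1 h2) hne
      -- Chambers are convex, so this combination stays in the chamber; the weights make `a` vanish
      -- there, because `a v` and `a w` have opposite signs.
      have hz : C g (|a w| • v + |a v| • w) := by
        rw [hC] at hg hg' ⊢
        intro b hb
        have h1 := mul_pos (abs_pos.2 (hw.2 a ha)) (hg b hb)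
        have h2 := mul_pos (abs_pos.2 (hv.2 a ha)) (hg' b hb)
        simp only [map_add, map_smul, smul_eq_mul]
        linarith
      refine hreg g _ hp hz a ha ?_
      simp only [map_add, map_smul, smul_eq_mul]
      rcases (hv.2 a ha).lt_or_gt with h1 | h1
      · have h2 : 0 < a w := by nlinarith
        rw [abs_of_neg h1, abs_of_pos h2]
        ring
      · have h2 : a w < 0 := by nlinarith
        rw [abs_of_pos h1, abs_of_neg h2]
        ring
  have e2 : (fun v => {g | p g ∧ C g v}) '' regularPoints K A =
      (fun g => ({g} : Set γ)) '' {g | p g ∧ ∃ v ∈ K, C g v} := by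
    have hs : ∀ g v, p g → C g v → {g | p g ∧ C g v} = {g} := by
      intro g v hp hg
      ext g'
      simp only [Set.mem_ofPred_eq, Set.mem_singleton_iff]
      exact ⟨fun h => huniq _ _ v h.1 hp h.2 hg, fun h => h ▸ ⟨hp, hg⟩⟩
    ext s
    constructor
    · rintro ⟨v, hv, rfl⟩
      obtain ⟨g, hp, hg⟩ := hex v hv.2
      exact ⟨g, ⟨hp, v, hv.1, hg⟩, (hs g v hp hg).symm⟩
    · rintro ⟨g, ⟨hp, v, hv, hg⟩, rfl⟩
      exact ⟨v, ⟨hv, hreg g v hp hg⟩, hs g v hp hg⟩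
  rw [e, e2, Set.ncard_image_of_injective _ Set.singleton_injective]

variable {n : ℕ}

/-- Permute the entries of a tuple and change their signs. -/
def signedPerm {V : Type*} [AddCommGroup V] (g : Equiv.Perm (Fin n) × (Fin n → ℤˣ))
    (x : Fin n → V) : Fin n → V :=
  fun i => g.2 i • x (g.1 i)

/-- The Weyl chamber of type `B`. -/
def ChamberB (u : Fin n → ℝ) : Prop := StrictAnti u ∧ ∀ i, 0 < u i

/-- The Weyl chamber of type `D`. -/
def ChamberD (u : Fin n → ℝ) : Prop := StrictAnti u ∧ ∀ i j, i ≠ j → 0 < u i + u j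

theorem ChamberB.strictAnti_abs {u : Fin n → ℝ} (h : ChamberB u) : StrictAnti fun i => |u i| := by
  intro i j hij
  simp only [abs_of_pos (h.2 _)]
  exact h.1 hij

theorem ChamberD.strictAnti_abs {u : Fin n → ℝ} (h : ChamberD u) : StrictAnti fun i => |u i| := by
  intro i j hij
  have h1 := h.1 hij
  have h2 := h.2 i j hij.ne
  have h3 : |u j| < u i := abs_lt.2 ⟨by linarith, h1⟩
  exact h3.trans_le (le_abs_self _)

theorem abs_units_smul (e : ℤˣ) (a : ℝ) : |e • a| = |a| := by
  rcases Int.units_eq_one_or e with rfl | rfl <;> simp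

theorem units_smul_units_smul {V : Type*} [AddCommGroup V] (e : ℤˣ) (a : V) : e • e • a = a := by
  rw [smul_smul, Int.units_mul_self, one_smul]

theorem abs_signedPerm (g : Equiv.Perm (Fin n) × (Fin n → ℤˣ)) (v : Fin n → ℝ) (i : Fin n) :
    |signedPerm g v i| = |v (g.1 i)| :=
  abs_units_smul _ _

theorem exists_perm_antitone (f : Fin n → ℝ) : ∃ σ : Equiv.Perm (Fin n), Antitone (f ∘ σ) := by
  refine ⟨Tuple.sort fun i => -f i, fun i j hij => ?_⟩
  have := Tuple.monotone_sort (fun i => -f i) hij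
  simpa using this

theorem exists_perm_strictAnti {f : Fin n → ℝ} (hf : Function.Injective f) :
    ∃ σ : Equiv.Perm (Fin n), StrictAnti (f ∘ σ) := by
  obtain ⟨σ, h⟩ := exists_perm_antitone f
  exact ⟨σ, h.strictAnti_of_injective (hf.comp σ.injective)⟩

theorem perm_eq_of_strictAnti {f : Fin n → ℝ} {σ τ : Equiv.Perm (Fin n)}
    (h : StrictAnti (f ∘ σ)) (h' : StrictAnti (f ∘ τ)) : σ = τ := by
  have hf : Function.Injective f := by
    have := h.injective.comp σ.symm.injective
    rwa [Function.comp_assoc, Equiv.self_comp_symm, Function.comp_id] at this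
  have := Tuple.unique_antitone h.antitone h'.antitone
  ext1 i
  exact hf (congrFun this i)

theorem add_ne_zero_and_sub_ne_zero_of_strictAnti_abs {v : Fin n → ℝ} {σ : Equiv.Perm (Fin n)}
    (h : StrictAnti fun i => |v (σ i)|) {i j : Fin n} (hij : i ≠ j) :
    v i + v j ≠ 0 ∧ v i - v j ≠ 0 := by
  have hinj : |v i| ≠ |v j| := by
    intro e
    refine hij (σ.symm.injective (h.injective ?_))
    simpa using e
  constructor
  · intro e
    rw [add_eq_zero_iff_eq_neg] at e
    exact hinj (by rw [e, abs_neg])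
  · intro e
    rw [sub_eq_zero] at e
    exact hinj (by rw [e])

theorem injective_abs_of_regular {v : Fin n → ℝ}
    (h : ∀ a ∈ arrangementD fun i : Fin n => LinearMap.proj (R := ℝ) (φ := fun _ => ℝ) i,
      a v ≠ 0) : Function.Injective fun i => |v i| := by
  intro i j e
  by_contra hij
  rcases abs_eq_abs.1 e with e | e
  · exact h _ ⟨i, j, hij, Or.inl rfl⟩ (by simp [e])
  · exact h _ ⟨i, j, hij, Or.inr rfl⟩ (by simp [e])

/-- Signs that make all entries of a permuted tuple nonnegative. -/
theorem exists_signs (v : Fin n → ℝ) (σ : Equiv.Perm (Fin n)) :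
    ∃ ε : Fin n → ℤˣ, ∀ i, signedPerm (σ, ε) v i = |v (σ i)| := by
  refine ⟨fun i => if 0 ≤ v (σ i) then 1 else -1, fun i => ?_⟩
  by_cases h : 0 ≤ v (σ i)
  · simp [signedPerm, h, abs_of_nonneg h]
  · simp [signedPerm, h, abs_of_neg (not_le.1 h)]

theorem numRegions_arrangementA_proj (K : Submodule ℝ (Fin n → ℝ)) :
    numRegions K (arrangementA fun i => LinearMap.proj i) =
      {σ : Equiv.Perm (Fin n) | ∃ v ∈ K, StrictAnti (v ∘ σ)}.ncard := by
  have := numRegions_eq_ncard (K := K) (A := arrangementA fun i => LinearMap.proj i)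
    (fun _ : Equiv.Perm (Fin n) => True) (fun σ v => StrictAnti (v ∘ σ))
    (fun σ => {b | ∃ i j, i < j ∧ b = LinearMap.proj (R := ℝ) (φ := fun _ => ℝ) (σ i) -
      LinearMap.proj (R := ℝ) (φ := fun _ => ℝ) (σ j)}) ?_ ?_ ?_ ?_ ?_
  · simpa only [true_and] using this
  · intro σ v
    constructor
    · rintro h _ ⟨i, j, hij, rfl⟩
      simpa using h hij
    · intro h i j hij
      simpa using h _ ⟨i, j, hij, rfl⟩
  · rintro σ _ ⟨i, j, hij, rfl⟩
    exact Or.inl ⟨σ i, σ j, by simpa using hij.ne, rfl⟩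
  · rintro σ v - h _ ⟨i, j, hij, rfl⟩ e
    have e' : (v ∘ σ) (σ.symm i) = (v ∘ σ) (σ.symm j) := by simpa [sub_eq_zero] using e
    exact hij (σ.symm.injective (h.injective e'))
  · intro v hv
    have hinj : Function.Injective v := by
      intro i j e
      by_contra hij
      exact hv _ ⟨i, j, hij, rfl⟩ (by simp [e])
    obtain ⟨σ, h⟩ := exists_perm_strictAnti hinj
    exact ⟨σ, trivial, h⟩
  · exact fun σ τ v _ _ => perm_eq_of_strictAnti

/-- The coordinate `i ↦ ε i * v (σ i)` as a functional. -/
def signedProj (g : Equiv.Perm (Fin n) × (Fin n → ℤˣ)) (i : Fin n) : Module.Dual ℝ (Fin n → ℝ) :=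
  g.2 i • LinearMap.proj (g.1 i)

theorem signedProj_mem (g : Equiv.Perm (Fin n) × (Fin n → ℤˣ)) (i : Fin n) :
    signedProj g i ∈ Set.range (fun i : Fin n => LinearMap.proj (R := ℝ) (φ := fun _ => ℝ) i) ∨
    -signedProj g i ∈ Set.range fun i : Fin n => LinearMap.proj (R := ℝ) (φ := fun _ => ℝ) i := by
  rcases Int.units_eq_one_or (g.2 i) with h | h
  · exact Or.inl ⟨g.1 i, by simp [signedProj, h]⟩
  · exact Or.inr ⟨g.1 i, by simp [signedProj, h]⟩

theorem signedProj_add_sub_mem (g : Equiv.Perm (Fin n) × (Fin n → ℤˣ)) {i j : Fin n}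
    (hij : i ≠ j) {b : Module.Dual ℝ (Fin n → ℝ)}
    (hb : b = signedProj g i - signedProj g j ∨ b = signedProj g i + signedProj g j) :
    b ∈ arrangementD (fun i : Fin n => LinearMap.proj (R := ℝ) (φ := fun _ => ℝ) i) ∨
    -b ∈ arrangementD fun i : Fin n => LinearMap.proj (R := ℝ) (φ := fun _ => ℝ) i := by
  have hij' : g.1 i ≠ g.1 j := by simpa using hij
  have e : ∀ i, g.2 i = 1 → signedProj g i = LinearMap.proj (R := ℝ) (φ := fun _ => ℝ) (g.1 i) :=
    fun i h => by simp [signedProj, h]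
  have e' : ∀ i, g.2 i = -1 →
      signedProj g i = -LinearMap.proj (R := ℝ) (φ := fun _ => ℝ) (g.1 i) :=
    fun i h => by simp [signedProj, h]
  rcases Int.units_eq_one_or (g.2 i) with hi | hi <;>
    rcases Int.units_eq_one_or (g.2 j) with hj | hj <;> rcases hb with rfl | rfl
  · exact Or.inl ⟨_, _, hij', Or.inl (by rw [e i hi, e j hj])⟩
  · exact Or.inl ⟨_, _, hij', Or.inr (by rw [e i hi, e j hj])⟩
  · exact Or.inl ⟨_, _, hij', Or.inr (by rw [e i hi, e' j hj]; abel)⟩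
  · exact Or.inl ⟨_, _, hij', Or.inl (by rw [e i hi, e' j hj]; abel)⟩
  · exact Or.inr ⟨_, _, hij', Or.inr (by rw [e' i hi, e j hj]; abel)⟩
  · exact Or.inr ⟨_, _, hij', Or.inl (by rw [e' i hi, e j hj]; abel)⟩
  · exact Or.inr ⟨_, _, hij', Or.inl (by rw [e' i hi, e' j hj]; abel)⟩
  · exact Or.inr ⟨_, _, hij', Or.inr (by rw [e' i hi, e' j hj]; abel)⟩

theorem units_eq_of_smul_pos {e e' : ℤˣ} {a : ℝ} (h : 0 < e • a) (h' : 0 < e' • a) : e = e' := by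
  rcases Int.units_eq_one_or e with rfl | rfl <;> rcases Int.units_eq_one_or e' with rfl | rfl
  · rfl
  · rw [one_smul] at h
    simp only [Units.smul_def, Units.val_neg, Units.val_one, neg_smul, one_smul] at h'
    linarith
  · rw [one_smul] at h'
    simp only [Units.smul_def, Units.val_neg, Units.val_one, neg_smul, one_smul] at h
    linarith
  · rfl

theorem numRegions_arrangementB_proj (K : Submodule ℝ (Fin n → ℝ)) :
    numRegions K (arrangementB fun i => LinearMap.proj i) =
      {g : Equiv.Perm (Fin n) × (Fin n → ℤˣ) | ∃ v ∈ K, ChamberB (signedPerm g v)}.ncard := by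
  have := numRegions_eq_ncard (K := K) (A := arrangementB fun i => LinearMap.proj i)
    (fun _ : Equiv.Perm (Fin n) × (Fin n → ℤˣ) => True) (fun g v => ChamberB (signedPerm g v))
    (fun g => Set.range (signedProj g) ∪
      {b | ∃ i j, i < j ∧ b = signedProj g i - signedProj g j}) ?_ ?_ ?_ ?_ ?_
  · simpa only [true_and] using this
  · intro g v
    constructor
    · rintro h _ (⟨i, rfl⟩ | ⟨i, j, hij, rfl⟩)
      · exact h.2 i
      · exact sub_pos.2 (h.1 hij)
    · intro h
      exact ⟨fun i j hij => sub_pos.1 (h _ (Or.inr ⟨i, j, hij, rfl⟩)),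
        fun i => h _ (Or.inl ⟨i, rfl⟩)⟩
  · rintro g _ (⟨i, rfl⟩ | ⟨i, j, hij, rfl⟩)
    · exact (signedProj_mem g i).imp Or.inl Or.inl
    · exact (signedProj_add_sub_mem g hij.ne (Or.inl rfl)).imp Or.inr Or.inr
  · rintro g v - h _ (⟨i, rfl⟩ | ⟨i, j, hij, hb⟩)
    · have h1 := abs_pos.2 (h.2 (g.1.symm i)).ne'
      rw [abs_signedPerm, Equiv.apply_symm_apply] at h1
      exact abs_pos.1 h1
    · have h1 := h.strictAnti_abs
      simp only [abs_signedPerm] at h1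
      have h2 := add_ne_zero_and_sub_ne_zero_of_strictAnti_abs h1 hij
      rcases hb with rfl | rfl
      · exact h2.2
      · exact h2.1
  · intro v hv
    obtain ⟨σ, h⟩ := exists_perm_strictAnti
      (injective_abs_of_regular fun a ha => hv a (Or.inr ha))
    obtain ⟨ε, hε⟩ := exists_signs v σ
    refine ⟨(σ, ε), trivial, ?_⟩
    rw [funext hε]
    exact ⟨h, fun i => abs_pos.2 (hv _ (Or.inl ⟨σ i, rfl⟩))⟩
  · rintro ⟨σ, ε⟩ ⟨τ, ε'⟩ v - - h h'
    have h1 := h.strictAnti_abs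
    have h2 := h'.strictAnti_abs
    simp only [abs_signedPerm] at h1 h2
    obtain rfl := perm_eq_of_strictAnti (f := fun i => |v i|) h1 h2
    congr 1
    ext1 i
    exact units_eq_of_smul_pos (h.2 i) (h'.2 i)

theorem ChamberB.chamberD {u : Fin n → ℝ} (h : ChamberB u) : ChamberD u :=
  ⟨h.1, fun i j _ => add_pos (h.2 i) (h.2 j)⟩

/-- Change the sign of the last entry of a tuple. -/
def flipLast {V : Type*} [AddCommGroup V] (x : Fin n → V) : Fin n → V :=
  fun i => if (i : ℕ) + 1 < n then x i else -x i

/-- Negating the last entry exchanges the conditions that the other entries exceed it and that their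
sums with it are positive. -/
theorem ChamberD.flipLast {u : Fin n → ℝ} (h : ChamberD u) : ChamberD (flipLast u) := by
  constructor
  · intro i j hij
    have h1 := h.1 hij
    have h2 := h.2 i j hij.ne
    have hi : (i : ℕ) + 1 < n := by omega
    simp only [_root_.flipLast, if_pos hi]
    split_ifs
    · exact h1
    · linarith
  · intro i j hij
    have h2 := h.2 i j hij
    have hij' : (i : ℕ) ≠ j := Fin.val_ne_of_ne hij
    simp only [_root_.flipLast]
    split_ifs with h3 h4 h4
    · exact h2
    · have := h.1 (show i < j from Fin.lt_def.2 (by omega))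
      linarith
    · have := h.1 (show j < i from Fin.lt_def.2 (by omega))
      linarith
    · omega

/-- Only the last entry can vanish, so any two entries have a positive sum. A regular vector of type
D may have one zero coordinate, hence the weak inequality. -/
theorem chamberD_of_nonneg {u : Fin n → ℝ} (h : StrictAnti u) (h0 : ∀ i, 0 ≤ u i) :
    ChamberD u := by
  refine ⟨h, fun i j hij => ?_⟩
  have hi := h0 i
  have hj := h0 j
  rcases hij.lt_or_gt with h1 | h1
  · have := h h1
    linarith
  · have := h h1
    linarith

theorem signedPerm_flipLast_signs {V : Type*} [AddCommGroup V] (σ : Equiv.Perm (Fin n))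
    (ε : Fin n → ℤˣ) (x : Fin n → V) :
    signedPerm (σ, fun i => if (i : ℕ) + 1 < n then ε i else -ε i) x =
      flipLast (signedPerm (σ, ε) x) := by
  funext i
  simp only [signedPerm, flipLast]
  split_ifs
  · rfl
  · rw [Units.smul_def, Units.smul_def, Units.val_neg, neg_smul]

theorem prod_flipLast_signs (hn : 0 < n) (ε : Fin n → ℤˣ) :
    ∏ i : Fin n, (if (i : ℕ) + 1 < n then ε i else -ε i) = -∏ i, ε i := by
  obtain ⟨n, rfl⟩ : ∃ m, n = m + 1 := ⟨n - 1, by omega⟩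
  rw [Fin.prod_univ_castSucc, Fin.prod_univ_castSucc]
  simp

theorem numRegions_arrangementD_proj (hn : 0 < n) (K : Submodule ℝ (Fin n → ℝ)) :
    numRegions K (arrangementD fun i => LinearMap.proj i) =
      {g : Equiv.Perm (Fin n) × (Fin n → ℤˣ) | ∏ i, g.2 i = 1 ∧
        ∃ v ∈ K, ChamberD (signedPerm g v)}.ncard := by
  apply numRegions_eq_ncard (K := K) (A := arrangementD fun i => LinearMap.proj i)
    (fun g : Equiv.Perm (Fin n) × (Fin n → ℤˣ) => ∏ i, g.2 i = 1)
    (fun g v => ChamberD (signedPerm g v))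
    (fun g => {b | ∃ i j, i ≠ j ∧ b = signedProj g i + signedProj g j} ∪
      {b | ∃ i j, i < j ∧ b = signedProj g i - signedProj g j})
  · intro g v
    constructor
    · rintro h _ (⟨i, j, hij, rfl⟩ | ⟨i, j, hij, rfl⟩)
      · exact h.2 i j hij
      · exact sub_pos.2 (h.1 hij)
    · intro h
      exact ⟨fun i j hij => sub_pos.1 (h _ (Or.inr ⟨i, j, hij, rfl⟩)),
        fun i j hij => h _ (Or.inl ⟨i, j, hij, rfl⟩)⟩
  · rintro g _ (⟨i, j, hij, rfl⟩ | ⟨i, j, hij, rfl⟩)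
    · exact signedProj_add_sub_mem g hij (Or.inr rfl)
    · exact signedProj_add_sub_mem g hij.ne (Or.inl rfl)
  · rintro g v - h _ ⟨i, j, hij, hb⟩
    have h1 := h.strictAnti_abs
    simp only [abs_signedPerm] at h1
    have h2 := add_ne_zero_and_sub_ne_zero_of_strictAnti_abs h1 hij
    rcases hb with rfl | rfl
    · exact h2.2
    · exact h2.1
  · intro v hv
    obtain ⟨σ, h⟩ := exists_perm_strictAnti (injective_abs_of_regular hv)
    obtain ⟨ε, hε⟩ := exists_signs v σ
    have hD : ChamberD (signedPerm (σ, ε) v) := by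
      rw [funext hε]
      exact chamberD_of_nonneg h fun i => abs_nonneg _
    -- The signs that make all entries nonnegative may have product `-1`; flipping the last one
    -- repairs this without leaving the chamber.
    rcases Int.units_eq_one_or (∏ i, ε i) with hp | hp
    · exact ⟨(σ, ε), hp, hD⟩
    · refine ⟨(σ, fun i => if (i : ℕ) + 1 < n then ε i else -ε i), ?_, ?_⟩
      · simp only [prod_flipLast_signs hn, hp, neg_neg]
      · rw [signedPerm_flipLast_signs]
        exact hD.flipLast
  · rintro ⟨σ, ε⟩ ⟨τ, ε'⟩ v hp hp' h h'
    have h1 := h.strictAnti_abs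
    have h2 := h'.strictAnti_abs
    simp only [abs_signedPerm] at h1 h2
    obtain rfl := perm_eq_of_strictAnti (f := fun i => |v i|) h1 h2
    congr 1
    obtain ⟨n, rfl⟩ : ∃ m, n = m + 1 := ⟨n - 1, by omega⟩
    -- Adding `u i > u last` and `u i + u last > 0` shows that every entry but the last is positive,
    -- so its sign is determined. The product condition then determines the last sign.
    have hlt : ∀ i : Fin n, ε i.castSucc = ε' i.castSucc := by
      intro i
      have k1 := h.1 (Fin.castSucc_lt_last i)
      have k2 := h.2 _ _ (Fin.castSucc_lt_last i).ne
      have k3 := h'.1 (Fin.castSucc_lt_last i)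
      have k4 := h'.2 _ _ (Fin.castSucc_lt_last i).ne
      exact units_eq_of_smul_pos (a := v (σ i.castSucc)) (by
        change 0 < signedPerm (σ, ε) v i.castSucc
        linarith) (by
        change 0 < signedPerm (σ, ε') v i.castSucc
        linarith)
    ext1 i
    cases i using Fin.lastCases with
    | cast i => exact hlt i
    | last =>
      simp only [Fin.prod_univ_castSucc, hlt] at hp hp'
      rw [← hp'] at hp
      exact mul_left_cancel hp

end Chambers

/-! ### Positive relations between vectors in general position -/

section PositiveCombinations

variable {V : Type*} [AddCommGroup V] [Module ℝ V]

/-- A relation `∑ w_k s_k = 0` can be rescaled, so the weights need not sum to one. This leaves room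
to modify them later. -/
theorem zero_mem_convexHull_image_iff {κ : Type*} {t : Finset κ} {s : κ → V} :
    (0 : V) ∈ convexHull ℝ (s '' t) ↔
      ∃ w : κ → ℝ, (∀ k ∈ t, 0 ≤ w k) ∧ (∃ k ∈ t, 0 < w k) ∧ ∑ k ∈ t, w k • s k = 0 := by
  classical
  constructor
  · intro h
    have hsub : convexHull ℝ (s '' t) ⊆
        {v | ∃ w : κ → ℝ, (∀ k ∈ t, 0 ≤ w k) ∧ ∑ k ∈ t, w k = 1 ∧ ∑ k ∈ t, w k • s k = v} := by
      refine convexHull_min ?_ ?_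
      · rintro _ ⟨k, hk, rfl⟩
        refine ⟨Pi.single k 1, fun j _ => ?_, ?_, ?_⟩
        · by_cases h : j = k
          · subst h
            simp
          · simp [h]
        · simpa [Finset.sum_pi_single] using hk
        · have hk' : k ∈ t := hk
          rw [Finset.sum_eq_single k]
          · simp
          · intro j _ hj
            simp [hj]
          · exact fun h => absurd hk' h
      · rintro _ ⟨w, hw, hw1, rfl⟩ _ ⟨w', hw', hw1', rfl⟩ a b ha hb hab
        refine ⟨fun k => a * w k + b * w' k, fun k hk => ?_, ?_, ?_⟩
        · exact add_nonneg (mul_nonneg ha (hw k hk)) (mul_nonneg hb (hw' k hk))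
        · rw [Finset.sum_add_distrib, ← Finset.mul_sum, ← Finset.mul_sum, hw1, hw1', mul_one,
            mul_one, hab]
        · simp only [add_smul, mul_smul, Finset.sum_add_distrib, Finset.smul_sum]
    obtain ⟨w, hw, hw1, h0⟩ := hsub h
    refine ⟨w, hw, ?_, h0⟩
    by_contra! hcon
    have := Finset.sum_nonpos hcon
    linarith
  · rintro ⟨w, hw, hpos, h0⟩
    have := Finset.centerMass_mem_convexHull t hw (Finset.sum_pos' hw hpos) (z := s)
      (s := s '' t) fun k hk => ⟨k, hk, rfl⟩
    rwa [Finset.centerMass, h0, smul_zero] at this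

/-- A nonnegative relation whose support spans the space can be made positive. -/
theorem exists_pos_relation {κ : Type*} {t : Finset κ} {s : κ → V} {w : κ → ℝ}
    (hw : ∀ k ∈ t, 0 ≤ w k) (h0 : ∑ k ∈ t, w k • s k = 0)
    (hspan : Submodule.span ℝ (s '' (t.filter fun k => w k ≠ 0 : Finset κ)) = ⊤) :
    ∃ w' : κ → ℝ, (∀ k ∈ t, 0 < w' k) ∧ ∑ k ∈ t, w' k • s k = 0 := by
  classical
  set J := t.filter fun k => w k ≠ 0
  -- Expressing `-∑ s k` through the support `J` yields a relation with coefficients `1 + c'` that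
  -- equal 1 off `J`. Adding a small positive multiple of it makes the zero weights positive and
  -- keeps the others positive.
  have hmem : -∑ k ∈ t, s k ∈ Submodule.span ℝ (s '' J) := hspan ▸ Submodule.mem_top
  obtain ⟨c, hc⟩ := (Submodule.mem_span_image_finset_iff_exists_fun ℝ).1 hmem
  let c' : κ → ℝ := fun k => if h : k ∈ J then c ⟨k, h⟩ else 0
  have hc' : ∑ k ∈ t, c' k • s k = -∑ k ∈ t, s k := by
    rw [← hc, ← Finset.sum_subset (Finset.filter_subset _ t : J ⊆ t), ← Finset.sum_coe_sort J]
    · refine Finset.sum_congr rfl fun k _ => ?_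
      simp [c']
    · intro k _ hk
      rw [show c' k = 0 from dif_neg hk, zero_smul]
  have hev : ∀ᶠ δ : ℝ in nhdsWithin 0 (Set.Ioi 0),
      (∀ k ∈ t, 0 < w k + δ * (1 + c' k)) := by
    rw [Filter.eventually_all_finset]
    intro k hk
    by_cases hJ : k ∈ J
    · have hwk : 0 < w k := lt_of_le_of_ne (hw k hk) (Finset.mem_filter.1 hJ).2.symm
      have hcont : Continuous fun δ : ℝ => w k + δ * (1 + c' k) := by fun_prop
      have := hcont.continuousAt.eventually (lt_mem_nhds (a := 0) (b := w k + 0 * (1 + c' k))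
        (by simpa using hwk))
      exact this.filter_mono nhdsWithin_le_nhds
    · filter_upwards [self_mem_nhdsWithin] with δ hδ
      have hδ' : 0 < δ := hδ
      have := hw k hk
      simp only [c', hJ, dite_false]
      linarith
  obtain ⟨δ, hδ⟩ := hev.exists
  refine ⟨_, hδ, ?_⟩
  simp only [add_smul, mul_smul, one_smul, Finset.sum_add_distrib, ← Finset.smul_sum]
  rw [h0, hc']
  simp

/-- Any `d` of the vectors `s 1, …, s m` are linearly independent. -/
def SubsetsIndependent (s : ℕ → V) (m d : ℕ) : Prop :=
  ∀ k : Fin d → ℕ, StrictMono k → (∀ j, 1 ≤ k j ∧ k j ≤ m) → LinearIndependent ℝ fun j => s (k j)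

theorem SubsetsIndependent.linearIndepOn {s : ℕ → V} {m d : ℕ} (h : SubsetsIndependent s m d)
    {T : Finset ℕ} (hT : T ⊆ Finset.Icc 1 m) (hd : T.card = d) : LinearIndepOn ℝ s (T : Set ℕ) := by
  have h1 := h (T.orderEmbOfFin hd) (T.orderEmbOfFin hd).strictMono
    fun j => Finset.mem_Icc.1 (hT (T.orderEmbOfFin_mem hd j))
  exact (linearIndependent_equiv (T.orderIsoOfFin hd).toEquiv).1 h1

/-- A support of at most `d` indices could be enlarged to exactly `d` of the `m` indices, whose
vectors are independent. -/
theorem SubsetsIndependent.lt_card {s : ℕ → V} {m d : ℕ} (h : SubsetsIndependent s m d)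
    (hdm : d ≤ m) {w : ℕ → ℝ} (h0 : ∑ k ∈ Finset.Icc 1 m, w k • s k = 0)
    (hw : ∃ k ∈ Finset.Icc 1 m, w k ≠ 0) :
    d < ((Finset.Icc 1 m).filter fun k => w k ≠ 0).card := by
  by_contra! hcon
  obtain ⟨T, hJT, hT, hd⟩ := Finset.exists_subsuperset_card_eq (Finset.filter_subset _ _) hcon
    (by simpa using hdm)
  have h1 := linearIndepOn_finset_iff.1 (h.linearIndepOn hT hd) w (by
    rw [← h0]
    refine Finset.sum_subset hT fun k hk hkT => ?_
    have : w k = 0 := by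
      by_contra hne
      exact hkT (hJT (Finset.mem_filter.2 ⟨hk, hne⟩))
    rw [this, zero_smul])
  obtain ⟨k, hk, hne⟩ := hw
  exact hne (h1 k (hJT (Finset.mem_filter.2 ⟨hk, hne⟩)))

/-- The support of a nonzero relation has more than `d` elements, hence contains a basis and spans,
and `exists_pos_relation` applies. -/
theorem SubsetsIndependent.exists_pos {s : ℕ → V} {m d : ℕ} [FiniteDimensional ℝ V]
    (h : SubsetsIndependent s m d) (hdm : d ≤ m) (hV : Module.finrank ℝ V = d)
    (h0 : (0 : V) ∈ convexHull ℝ (s '' (Finset.Icc 1 m : Finset ℕ))) :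
    ∃ w : ℕ → ℝ, (∀ k ∈ Finset.Icc 1 m, 0 < w k) ∧ ∑ k ∈ Finset.Icc 1 m, w k • s k = 0 := by
  obtain ⟨w, hw, ⟨k, hk, hwk⟩, h0⟩ := zero_mem_convexHull_image_iff.1 h0
  refine exists_pos_relation hw h0 ?_
  have h1 := h.lt_card hdm h0 ⟨k, hk, hwk.ne'⟩
  obtain ⟨T, hTJ, hT⟩ := Finset.exists_subset_card_eq h1.le
  have h2 := h.linearIndepOn (hTJ.trans (Finset.filter_subset _ _)) hT
  have h3 := LinearIndependent.span_eq_top_of_card_eq_finrank' h2 (by simp [hT, hV])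
  rw [eq_top_iff, ← h3]
  refine Submodule.span_mono ?_
  rintro _ ⟨⟨k, hk⟩, rfl⟩
  exact ⟨k, hTJ hk, rfl⟩

end PositiveCombinations

/-! ### Changing the sign of the last increment -/

section FlipLast

variable {V : Type*} [AddCommGroup V] {n : ℕ}

theorem flipLast_flipLast (y : Fin n → V) : flipLast (flipLast y) = y := by
  funext i
  simp only [flipLast]
  split_ifs <;> simp

theorem starSum_eq (y : Fin n → V) : starSum y = ∑ i, flipLast y i := rfl

theorem partialSum_self (y : Fin n → V) : partialSum y n = ∑ i, y i := by
  simp [partialSum]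

theorem partialSum_flipLast_of_lt (y : Fin n → V) {k : ℕ} (hk : k < n) :
    partialSum (flipLast y) k = partialSum y k := by
  refine Finset.sum_congr rfl fun i _ => ?_
  split_ifs with h
  · simp only [flipLast]
    rw [if_pos (by omega)]
  · rfl

theorem partialSum_flipLast_self (y : Fin n → V) : partialSum (flipLast y) n = starSum y := by
  rw [partialSum_self, starSum_eq]

theorem starSum_flipLast (y : Fin n → V) : starSum (flipLast y) = partialSum y n := by
  rw [partialSum_self, starSum_eq, flipLast_flipLast]

theorem starredPartialSum_flipLast (y : Fin n → V) {k : ℕ} (hk : k ≤ n) :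
    starredPartialSum (flipLast y) k = partialSum y k := by
  unfold starredPartialSum
  split_ifs with h
  · exact partialSum_flipLast_of_lt y h
  · rw [starSum_flipLast, le_antisymm hk (not_lt.1 h)]

end FlipLast

/-! ### Membership of the origin in the hulls, through monotone relations between increments -/

section PartialSums

variable {V : Type*} [AddCommGroup V] [Module ℝ V] {n d : ℕ}

theorem hullA_eq (y : Fin n → V) :
    hullA y = convexHull ℝ (partialSum y '' (Finset.Icc 1 (n - 1) : Finset ℕ)) := by
  unfold hullA
  congr 1
  ext v
  simp only [Set.mem_ofPred_eq, Finset.coe_Icc, Set.mem_image, Set.mem_Icc]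
  constructor
  · rintro ⟨k, h1, h2, rfl⟩
    exact ⟨k, ⟨h1, by omega⟩, rfl⟩
  · rintro ⟨k, ⟨h1, h2⟩, rfl⟩
    exact ⟨k, h1, by omega, rfl⟩

theorem hullB_eq (y : Fin n → V) :
    hullB y = convexHull ℝ (partialSum y '' (Finset.Icc 1 n : Finset ℕ)) := by
  unfold hullB
  congr 1
  ext v
  simp only [Set.mem_ofPred_eq, Finset.coe_Icc, Set.mem_image, Set.mem_Icc]
  constructor
  · rintro ⟨k, h1, h2, rfl⟩
    exact ⟨k, ⟨h1, h2⟩, rfl⟩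
  · rintro ⟨k, ⟨h1, h2⟩, rfl⟩
    exact ⟨k, h1, h2, rfl⟩

/-- Summation by parts. -/
theorem sum_smul_partialSum (y : Fin n → V) (w : ℕ → ℝ) (m : ℕ) :
    ∑ k ∈ Finset.Icc 1 m, w k • partialSum y k =
      ∑ i : Fin n, (∑ k ∈ Finset.Ioc (i : ℕ) m, w k) • y i := by
  simp only [partialSum, Finset.smul_sum, smul_ite, smul_zero]
  rw [Finset.sum_comm]
  refine Finset.sum_congr rfl fun i _ => ?_
  rw [← Finset.sum_filter, Finset.sum_smul]
  refine Finset.sum_congr ?_ fun _ _ => rfl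
  ext k
  simp only [Finset.mem_filter, Finset.mem_Icc, Finset.mem_Ioc]
  omega

theorem sum_Ioc_sub_pred (f : ℕ → ℝ) {i m : ℕ} (h : i ≤ m) :
    ∑ k ∈ Finset.Ioc i m, (f (k - 1) - f k) = f i - f m := by
  induction m, h using Nat.le_induction with
  | base => simp
  | succ m h ih =>
    rw [Finset.sum_Ioc_succ_top h, ih, Nat.add_sub_cancel]
    ring

theorem sum_Ioc_strictAnti {w : ℕ → ℝ} {m i j : ℕ} (hw : ∀ k ∈ Finset.Icc 1 m, 0 < w k)
    (hij : i < j) (hj : j ≤ m) : ∑ k ∈ Finset.Ioc j m, w k < ∑ k ∈ Finset.Ioc i m, w k := by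
  refine Finset.sum_lt_sum_of_subset (i := j) (Finset.Ioc_subset_Ioc_left hij.le)
    (by simp [hij, hj]) (by simp) (hw j (by simp; omega)) fun k hk _ => (hw k ?_).le
  simp only [Finset.mem_Ioc, Finset.mem_Icc] at hk ⊢
  omega

/-- Extension of a tuple by zeros. -/
def extendZero (u : Fin n → ℝ) (k : ℕ) : ℝ := if h : k < n then u ⟨k, h⟩ else 0

theorem extendZero_val (u : Fin n → ℝ) (i : Fin n) : extendZero u i = u i := by
  simp [extendZero]

theorem extendZero_self (u : Fin n → ℝ) : extendZero u n = 0 := by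
  simp [extendZero]

/-- Both ranges of summation are needed: for `m = n` the correction vanishes because the extension
is zero there, and for `m = n - 1` it vanishes for a bridge because the increments sum to zero. -/
theorem sum_extendZero_smul_partialSum (y : Fin n → V) (u : Fin n → ℝ) {m : ℕ} (hm : n ≤ m + 1) :
    ∑ k ∈ Finset.Icc 1 m, (extendZero u (k - 1) - extendZero u k) • partialSum y k =
      ∑ i, u i • y i - extendZero u m • ∑ i, y i := by
  rw [sum_smul_partialSum, Finset.smul_sum, ← Finset.sum_sub_distrib]
  refine Finset.sum_congr rfl fun i _ => ?_
  rw [sum_Ioc_sub_pred _ (by omega), extendZero_val, sub_smul]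

/-- The chamber vector consists of the tail sums of a strictly positive relation between the partial
sums. Positivity of its entries is strict decrease down to the empty tail at `n`. -/
theorem exists_chamberB_of_zero_mem_hullB [FiniteDimensional ℝ V] {y : Fin n → V}
    (h : SubsetsIndependent (partialSum y) n d) (hdn : d ≤ n) (hV : Module.finrank ℝ V = d)
    (h0 : (0 : V) ∈ hullB y) : ∃ u, ChamberB u ∧ ∑ i, u i • y i = 0 := by
  rw [hullB_eq] at h0
  obtain ⟨w, hw, h1⟩ := h.exists_pos hdn hV h0
  rw [sum_smul_partialSum] at h1
  refine ⟨_, ⟨fun i j hij => sum_Ioc_strictAnti hw hij j.2.le, fun i => ?_⟩, h1⟩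
  exact (by simp : (0 : ℝ) = ∑ k ∈ Finset.Ioc n n, w k).trans_lt (sum_Ioc_strictAnti hw i.2 le_rfl)

theorem exists_strictAnti_of_zero_mem_hullA [FiniteDimensional ℝ V] {y : Fin n → V}
    (h : SubsetsIndependent (partialSum y) (n - 1) d) (hdn : d + 1 ≤ n)
    (hV : Module.finrank ℝ V = d) (h0 : (0 : V) ∈ hullA y) :
    ∃ u : Fin n → ℝ, StrictAnti u ∧ ∑ i, u i • y i = 0 := by
  rw [hullA_eq] at h0
  obtain ⟨w, hw, h1⟩ := h.exists_pos (by omega) hV h0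
  rw [sum_smul_partialSum] at h1
  exact ⟨_, fun i j hij => sum_Ioc_strictAnti hw hij (by omega), h1⟩

theorem extendZero_anti {u : Fin n → ℝ} (hu : Antitone u) (hu0 : ∀ i, 0 ≤ u i) {k : ℕ}
    (hk : k ∈ Finset.Icc 1 n) : 0 ≤ extendZero u (k - 1) - extendZero u k := by
  rw [Finset.mem_Icc] at hk
  rw [extendZero, dif_pos (by omega : k - 1 < n), extendZero]
  split_ifs with h
  · exact sub_nonneg.2 (hu (by simp [Fin.le_def]))
  · simpa using hu0 _

/-- The weights of the partial sums are the descents of `u`, with a final descent to zero; they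
cannot all vanish, since they add up to the entries of `u`. -/
theorem zero_mem_hullB_of_antitone {y : Fin n → V} {u : Fin n → ℝ} (hu : Antitone u)
    (hu0 : ∀ i, 0 ≤ u i) (hne : ∃ i, u i ≠ 0) (h : ∑ i, u i • y i = 0) : (0 : V) ∈ hullB y := by
  rw [hullB_eq, zero_mem_convexHull_image_iff]
  refine ⟨_, fun k hk => extendZero_anti hu hu0 hk, ?_, ?_⟩
  · by_contra! hcon
    obtain ⟨i, hi⟩ := hne
    have h1 := sum_Ioc_sub_pred (extendZero u) i.2.le
    rw [extendZero_self, extendZero_val, sub_zero] at h1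
    have h2 : ∑ k ∈ Finset.Ioc (i : ℕ) n, (extendZero u (k - 1) - extendZero u k) ≤ 0 :=
      Finset.sum_nonpos fun k hk => hcon k (by
        simp only [Finset.mem_Ioc, Finset.mem_Icc] at hk ⊢
        omega)
    exact hi (le_antisymm (h1 ▸ h2) (hu0 i))
  · rw [sum_extendZero_smul_partialSum y u (by omega), h, extendZero_self, zero_smul, sub_zero]

theorem extendZero_pred_pos {u : Fin n → ℝ} (hu : StrictAnti u) {k : ℕ}
    (hk : k ∈ Finset.Icc 1 (n - 1)) : 0 < extendZero u (k - 1) - extendZero u k := by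
  rw [Finset.mem_Icc] at hk
  rw [extendZero, dif_pos (by omega : k - 1 < n), extendZero, dif_pos (by omega)]
  refine sub_pos.2 (hu ?_)
  simp only [Fin.lt_def]
  omega

theorem zero_mem_hullA_of_strictAnti (hn : 2 ≤ n) {y : Fin n → V} (hy : ∑ i, y i = 0)
    {u : Fin n → ℝ} (hu : StrictAnti u) (h : ∑ i, u i • y i = 0) : (0 : V) ∈ hullA y := by
  rw [hullA_eq, zero_mem_convexHull_image_iff]
  refine ⟨_, fun k hk => (extendZero_pred_pos hu hk).le, ⟨1, ?_, extendZero_pred_pos hu ?_⟩, ?_⟩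
  · simp only [Finset.mem_Icc]
    omega
  · simp only [Finset.mem_Icc]
    omega
  · rw [sum_extendZero_smul_partialSum y u (by omega), h, hy, smul_zero, sub_zero]

theorem partialSum_add_starSum (hn : 2 ≤ n) (y : Fin n → V) :
    partialSum y n + starSum y = (2 : ℝ) • partialSum y (n - 1) := by
  rw [starSum, partialSum_self, ← Finset.sum_add_distrib, partialSum, Finset.smul_sum]
  refine Finset.sum_congr rfl fun i _ => ?_
  by_cases h : (i : ℕ) + 1 < n
  · rw [if_pos h, if_pos (by omega), two_smul]
  · rw [if_neg h, if_neg (by omega)]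
    simp

theorem hullD_eq (y : Fin n → V) :
    hullD y = convexHull ℝ ((fun k => if k ≤ n then partialSum y k else starSum y) ''
      (Finset.Icc 1 (n + 1) : Finset ℕ)) := by
  unfold hullD
  congr 1
  ext v
  simp only [Set.mem_union, Set.mem_ofPred_eq, Finset.coe_Icc, Set.mem_image, Set.mem_Icc,
    Set.mem_singleton_iff]
  constructor
  · rintro (⟨k, h1, h2, rfl⟩ | rfl)
    · exact ⟨k, ⟨h1, by omega⟩, by simp [h2]⟩
    · exact ⟨n + 1, ⟨by omega, le_rfl⟩, by simp⟩
  · rintro ⟨k, ⟨h1, h2⟩, rfl⟩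
    split_ifs with h
    · exact Or.inl ⟨k, h1, h, rfl⟩
    · exact Or.inr rfl

theorem hullB_subset_hullD (y : Fin n → V) : hullB y ⊆ hullD y :=
  convexHull_mono Set.subset_union_left

theorem hullB_flipLast_subset_hullD (y : Fin n → V) : hullB (flipLast y) ⊆ hullD y := by
  refine convexHull_mono ?_
  rintro _ ⟨k, h1, h2, rfl⟩
  rcases h2.lt_or_eq with h | rfl
  · exact Or.inl ⟨k, h1, h2, partialSum_flipLast_of_lt y h⟩
  · exact Or.inr (partialSum_flipLast_self y)

/-- Substituting `S_n^* = 2 S_{n-1} - S_n` removes the starred sum; the weight of `S_n` becomes `w n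
- b`, which is still nonnegative. -/
theorem zero_mem_hullB_of_relation (hn : 2 ≤ n) {y : Fin n → V} {w : ℕ → ℝ} {b : ℝ}
    (hw : ∀ k ∈ Finset.Icc 1 n, 0 ≤ w k) (hpos : ∃ k ∈ Finset.Icc 1 n, 0 < w k) (hb : 0 ≤ b)
    (hbw : b ≤ w n) (h : ∑ k ∈ Finset.Icc 1 n, w k • partialSum y k + b • starSum y = 0) :
    (0 : V) ∈ hullB y := by
  rw [hullB_eq, zero_mem_convexHull_image_iff]
  refine ⟨fun k => w k + ((if k = n - 1 then 2 * b else 0) - if k = n then b else 0), ?_, ?_, ?_⟩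
  · intro k hk
    have := hw k hk
    beta_reduce
    split_ifs with h1 h2 h2
    · omega
    · linarith
    · subst h2
      linarith
    · linarith
  · rcases hb.eq_or_lt with rfl | hb
    · simpa using hpos
    · refine ⟨n - 1, by simp only [Finset.mem_Icc]; omega, ?_⟩
      beta_reduce
      rw [if_pos rfl, if_neg (by omega)]
      have := hw (n - 1) (by simp only [Finset.mem_Icc]; omega)
      linarith
  · simp only [add_smul, sub_smul, ite_smul, zero_smul, Finset.sum_add_distrib,
      Finset.sum_sub_distrib, Finset.sum_ite_eq', Finset.mem_Icc]
    rw [if_pos (by omega), if_pos (by omega), mul_comm, mul_smul, ← partialSum_add_starSum hn y,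
      smul_add]
    rw [← h]
    abel

/-- Of `S_n` and `S_n^*`, the one with the smaller weight can be eliminated. If that is `S_n`, the
last sign is flipped first, which exchanges the two. -/
theorem zero_mem_hullD_iff (hn : 2 ≤ n) (y : Fin n → V) :
    (0 : V) ∈ hullD y ↔ (0 : V) ∈ hullB y ∨ (0 : V) ∈ hullB (flipLast y) := by
  refine ⟨fun h => ?_, fun h => h.elim (hullB_subset_hullD y ·)
    (hullB_flipLast_subset_hullD y ·)⟩
  rw [hullD_eq, zero_mem_convexHull_image_iff] at h
  obtain ⟨w, hw, ⟨k, hk, hwk⟩, h0⟩ := h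
  rw [← Finset.insert_Icc_right_eq_Icc_add_one (by omega), Finset.sum_insert (by simp)] at h0
  have h1 : ∑ k ∈ Finset.Icc 1 n, w k • partialSum y k + w (n + 1) • starSum y = 0 := by
    rw [← h0, add_comm, if_neg (by omega)]
    congr 1
    refine Finset.sum_congr rfl fun k hk => ?_
    rw [if_pos (Finset.mem_Icc.1 hk).2]
  have hw' : ∀ k ∈ Finset.Icc 1 n, 0 ≤ w k := fun k hk => hw k (by
    simp only [Finset.mem_Icc] at hk ⊢
    omega)
  have hwn : 0 ≤ w (n + 1) := hw _ (by simp)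
  have hn' : n ∈ Finset.Icc 1 n := by
    simp only [Finset.mem_Icc]
    omega
  rcases le_or_gt (w (n + 1)) (w n) with hle | hlt
  · refine Or.inl (zero_mem_hullB_of_relation hn hw' ?_ hwn hle h1)
    rcases (Finset.mem_Icc.1 hk).2.lt_or_eq with h | rfl
    · exact ⟨k, by simp only [Finset.mem_Icc] at hk ⊢; omega, hwk⟩
    · exact ⟨n, hn', hwk.trans_le hle⟩
  -- For the flipped tuple the weights of `S_n` and `S_n^*` trade places, so the larger one now sits
  -- at index `n`.
  · refine Or.inr (zero_mem_hullB_of_relation hn (w := Function.update w n (w (n + 1)))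
      (b := w n) ?_ ⟨n, hn', ?_⟩ (hw' n hn') ?_ ?_)
    · intro k hk
      by_cases h : k = n
      · subst h
        simpa using hwn
      · simpa [h] using hw' k hk
    · simpa using (hw' n hn').trans_lt hlt
    · simpa using hlt.le
    · rw [starSum_flipLast, ← Finset.insert_Icc_sub_one_right_eq_Icc (by omega : 1 ≤ n),
        Finset.sum_insert (by simp; omega), Function.update_self, partialSum_flipLast_self]
      rw [← Finset.insert_Icc_sub_one_right_eq_Icc (by omega : 1 ≤ n),
        Finset.sum_insert (by simp; omega)] at h1
      rw [← h1, add_right_comm, add_comm]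
      rw [add_comm (w n • _), add_assoc]
      congr 1
      · refine Finset.sum_congr rfl fun k hk => ?_
        have hkn : k < n := by
          simp only [Finset.mem_Icc] at hk
          omega
        rw [Function.update_of_ne hkn.ne, partialSum_flipLast_of_lt y hkn]
      · abel

end PartialSums

/-! ### Group elements that lead to absorption, counted by regions of the relation space -/

section Counting

variable {V : Type*} [AddCommGroup V] [Module ℝ V] {n d : ℕ}

/-- The linear relations between the entries of `x`. -/
noncomputable def relations (x : Fin n → V) : Submodule ℝ (Fin n → ℝ) :=
  LinearMap.ker (Fintype.linearCombination ℝ x)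

theorem mem_relations {x : Fin n → V} {v : Fin n → ℝ} :
    v ∈ relations x ↔ ∑ i, v i • x i = 0 := by
  rw [relations, LinearMap.mem_ker, Fintype.linearCombination_apply]

theorem le_finrank_relations_add [FiniteDimensional ℝ V] (hV : Module.finrank ℝ V = d)
    (x : Fin n → V) : n ≤ Module.finrank ℝ (relations x) + d := by
  have h1 := LinearMap.finrank_range_add_finrank_ker (Fintype.linearCombination ℝ x)
  have h2 := Submodule.finrank_le (LinearMap.range (Fintype.linearCombination ℝ x))
  rw [Module.finrank_fin_fun] at h1
  unfold relations
  omega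

theorem smul_units_smul (e : ℤˣ) (a : ℝ) (v : V) : (e • a) • (e • v) = a • v := by
  rcases Int.units_eq_one_or e with rfl | rfl <;> simp [Units.smul_def]

theorem sum_signedPerm_smul (g : Equiv.Perm (Fin n) × (Fin n → ℤˣ)) (v : Fin n → ℝ)
    (x : Fin n → V) :
    ∑ i, signedPerm g v i • signedPerm g x i = ∑ i, v i • x i := by
  simp only [signedPerm, smul_units_smul]
  exact Equiv.sum_comp g.1 fun i => v i • x i

theorem exists_signedPerm_eq {W : Type*} [AddCommGroup W]
    (g : Equiv.Perm (Fin n) × (Fin n → ℤˣ)) (u : Fin n → W) : ∃ v, signedPerm g v = u := by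
  refine ⟨fun p => g.2 (g.1.symm p) • u (g.1.symm p), funext fun i => ?_⟩
  simp [signedPerm, units_smul_units_smul]

theorem extendZero_le {u : Fin n → ℝ} (hu : Antitone u) {i j : ℕ} (hij : i ≤ j) (hj : j < n) :
    extendZero u j ≤ extendZero u i := by
  rw [extendZero, extendZero, dif_pos hj, dif_pos (hij.trans_lt hj)]
  exact hu hij

/-- An antitone tuple takes distinct values before distinct descents. -/
theorem injOn_extendZero_pred {u : Fin n → ℝ} (hu : Antitone u) {J : Finset ℕ}
    (hJ : ∀ k ∈ J, 1 ≤ k ∧ k ≤ n ∧ (k < n → extendZero u (k - 1) - extendZero u k ≠ 0)) :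
    Set.InjOn (fun k => extendZero u (k - 1)) J := by
  have key : ∀ k ∈ J, ∀ k' ∈ J, k < k' → extendZero u (k' - 1) < extendZero u (k - 1) := by
    intro k hk k' hk' hlt
    have h1 := hJ k hk
    have h2 := hJ k' hk'
    have h3 := extendZero_le hu (Nat.sub_le k 1) (by omega)
    have h4 := h1.2.2 (by omega)
    have h5 := extendZero_le hu (i := k) (j := k' - 1) (by omega) (by omega)
    exact h5.trans_lt (lt_of_le_of_ne h3 fun e => h4 (by rw [e, sub_self]))
  intro k hk k' hk' e
  rcases lt_trichotomy k k' with h | h | h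
  · exact absurd e (key k hk k' hk' h).ne'
  · exact h
  · exact absurd e (key k' hk' k hk h).ne

/-- Sorting `|v|` turns a relation into one between the partial sums of a signed permutation of `x`,
weighted by the descents. General position forces more than `d` nonzero descents, and each is
preceded by its own positive value of `|v|`. -/
theorem genericB_relations [FiniteDimensional ℝ V] (hV : Module.finrank ℝ V = d) (hdn : d ≤ n)
    {x : Fin n → V} (hx : ∀ g, SubsetsIndependent (partialSum (signedPerm g x)) n d) :
    GenericB (relations x) (fun i => LinearMap.proj i) d := by
  refine ⟨le_finrank_relations_add hV x, fun v hv hv0 => ?_⟩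
  obtain ⟨σ, hσ⟩ := exists_perm_antitone fun i => |v i|
  obtain ⟨ε, hε⟩ := exists_signs v σ
  set u := signedPerm (σ, ε) v with hu_def
  have hu : Antitone u := by
    rw [funext hε]
    exact hσ
  have hu0 : ∀ i, 0 ≤ u i := fun i => hε i ▸ abs_nonneg _
  have h0 : ∑ k ∈ Finset.Icc 1 n, (extendZero u (k - 1) - extendZero u k) •
      partialSum (signedPerm (σ, ε) x) k = 0 := by
    rw [sum_extendZero_smul_partialSum _ _ (by omega), sum_signedPerm_smul, mem_relations.1 hv,
      extendZero_self, zero_smul, sub_zero]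
  have hne : ∃ k ∈ Finset.Icc 1 n, extendZero u (k - 1) - extendZero u k ≠ 0 := by
    by_contra! hcon
    refine hv0 (funext fun p => ?_)
    have h1 := sum_Ioc_sub_pred (extendZero u) (σ.symm p).2.le
    rw [extendZero_self, extendZero_val, sub_zero, Finset.sum_eq_zero fun k hk => hcon k (by
        simp only [Finset.mem_Ioc, Finset.mem_Icc] at hk ⊢
        omega), hε, Equiv.apply_symm_apply] at h1
    exact abs_eq_zero.1 h1.symm
  refine ((hx (σ, ε)).lt_card hdn h0 hne).trans_le ?_
  refine Finset.card_le_card_of_injOn (fun k => extendZero u (k - 1)) ?_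
    (injOn_extendZero_pred hu ?_)
  · intro k hk
    simp only [Finset.coe_filter, Set.mem_ofPred_eq, Finset.mem_Icc] at hk
    have h1 := extendZero_anti hu hu0 (Finset.mem_Icc.2 hk.1)
    have h2 : 0 < extendZero u (k - 1) - extendZero u k := lt_of_le_of_ne h1 hk.2.symm
    have h3 : 0 ≤ extendZero u k := by
      unfold extendZero
      split_ifs
      · exact hu0 _
      · exact le_rfl
    have h4 : k - 1 < n := by omega
    simp only [Finset.coe_erase, Finset.coe_image, Finset.coe_univ, Set.image_univ, Set.mem_sdiff,
      Set.mem_range, Set.mem_singleton_iff]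
    refine ⟨⟨σ ⟨k - 1, h4⟩, ?_⟩, by linarith⟩
    rw [extendZero, dif_pos h4, hε]
    rfl
  · intro k hk
    simp only [Finset.mem_filter, Finset.mem_Icc] at hk
    exact ⟨hk.1.1, hk.1.2, fun _ => hk.2⟩

/-- The sum of the coordinates. -/
noncomputable def coordSum (n : ℕ) : Module.Dual ℝ (Fin n → ℝ) :=
  Fintype.linearCombination ℝ fun _ => (1 : ℝ)

theorem coordSum_apply (v : Fin n → ℝ) : coordSum n v = ∑ i, v i := by
  simp [coordSum, Fintype.linearCombination_apply]

/-- As in type B, with `v` itself sorted. Constant vectors are relations of a bridge without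
descents; the condition on the coordinate sum excludes them. -/
theorem genericA_relations [FiniteDimensional ℝ V] (hV : Module.finrank ℝ V = d)
    (hdn : d + 1 ≤ n) {x : Fin n → V} (hsum : ∑ i, x i = 0)
    (hx : ∀ σ : Equiv.Perm (Fin n), SubsetsIndependent (partialSum (x ∘ σ)) (n - 1) d) :
    GenericA (relations x ⊓ LinearMap.ker (coordSum n)) (fun i => LinearMap.proj i) d := by
  refine ⟨?_, fun v hv hv0 => ?_⟩
  · have h1 := le_finrank_relations_add hV x
    have h2 := finrank_le_finrank_inf_ker (relations x) (coordSum n)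
    omega
  obtain ⟨σ, hu⟩ := exists_perm_antitone v
  set u := v ∘ σ with hu_def
  have hn1 : n - 1 < n := by omega
  have h0 : ∑ k ∈ Finset.Icc 1 (n - 1), (extendZero u (k - 1) - extendZero u k) •
      partialSum (x ∘ σ) k = 0 := by
    rw [sum_extendZero_smul_partialSum _ _ (by omega)]
    have h1 : ∑ i, u i • (x ∘ σ) i = 0 := by
      rw [← mem_relations.1 hv.1]
      exact Equiv.sum_comp σ fun i => v i • x i
    have h2 : ∑ i, (x ∘ σ) i = 0 := by
      rw [← hsum]
      exact Equiv.sum_comp σ x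
    rw [h1, h2, smul_zero, sub_zero]
  have hne : ∃ k ∈ Finset.Icc 1 (n - 1), extendZero u (k - 1) - extendZero u k ≠ 0 := by
    by_contra! hcon
    have hconst : ∀ p, v p = extendZero u (n - 1) := by
      intro p
      have h1 := sum_Ioc_sub_pred (extendZero u) (i := (σ.symm p : ℕ)) (m := n - 1) (by omega)
      rw [extendZero_val, Finset.sum_eq_zero fun k hk => hcon k (by
        simp only [Finset.mem_Ioc, Finset.mem_Icc] at hk ⊢
        omega), hu_def, Function.comp_apply, Equiv.apply_symm_apply] at h1
      linarith
    have h2 : ∑ i, v i = 0 := by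
      rw [← coordSum_apply]
      exact hv.2
    rw [Finset.sum_congr rfl fun p _ => hconst p, Finset.sum_const, Finset.card_univ,
      Fintype.card_fin, nsmul_eq_mul, mul_eq_zero] at h2
    refine hv0 (funext fun p => ?_)
    rw [hconst]
    exact h2.resolve_left (by simp; omega)
  have hcard := (hx σ).lt_card (by omega) h0 hne
  set J := (Finset.Icc 1 (n - 1)).filter fun k => extendZero u (k - 1) - extendZero u k ≠ 0
    with hJ
  have hnJ : n ∉ J := by
    simp only [hJ, Finset.mem_filter, Finset.mem_Icc]
    omega
  -- The extra index `n` stands for the value after the last descent, since there is one more value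
  -- than there are descents.
  refine (show d + 1 < (insert n J).card by rw [Finset.card_insert_of_notMem hnJ]; omega).trans_le ?_
  refine Finset.card_le_card_of_injOn (fun k => extendZero u (k - 1)) ?_
    (injOn_extendZero_pred hu ?_)
  · intro k hk
    have h4 : k - 1 < n := by
      simp only [hJ, Finset.coe_insert, Set.mem_insert_iff, Finset.mem_coe, Finset.mem_filter,
        Finset.mem_Icc] at hk
      omega
    simp only [Finset.coe_image, Finset.coe_univ, Set.image_univ, Set.mem_range]
    refine ⟨σ ⟨k - 1, h4⟩, ?_⟩
    rw [extendZero, dif_pos h4]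
    rfl
  · intro k hk
    simp only [hJ, Finset.mem_insert, Finset.mem_filter, Finset.mem_Icc] at hk
    rcases hk with rfl | hk
    · exact ⟨by omega, le_rfl, fun h => absurd h (lt_irrefl _)⟩
    · exact ⟨hk.1.1, by omega, fun _ => hk.2⟩

theorem ncard_zero_mem_hullB [FiniteDimensional ℝ V] (hV : Module.finrank ℝ V = d) (hd : 1 ≤ d)
    (hdn : d ≤ n) {x : Fin n → V}
    (hx : ∀ g, SubsetsIndependent (partialSum (signedPerm g x)) n d) :
    {g : Equiv.Perm (Fin n) × (Fin n → ℤˣ) | (0 : V) ∈ hullB (signedPerm g x)}.ncard =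
      regionCountB n d := by
  rw [← (genericB_relations hV hdn hx).numRegions_eq (by omega), numRegions_arrangementB_proj]
  congr 1
  ext g
  constructor
  · intro h
    obtain ⟨u, hu, h0⟩ := exists_chamberB_of_zero_mem_hullB (hx g) hdn hV h
    obtain ⟨v, rfl⟩ := exists_signedPerm_eq g u
    exact ⟨v, mem_relations.2 (by rwa [sum_signedPerm_smul] at h0), hu⟩
  · rintro ⟨v, hv, hu⟩
    exact zero_mem_hullB_of_antitone hu.1.antitone (fun i => (hu.2 i).le)
      ⟨⟨0, by omega⟩, (hu.2 _).ne'⟩ (by rw [sum_signedPerm_smul, mem_relations.1 hv])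

theorem ncard_zero_mem_hullA [FiniteDimensional ℝ V] (hV : Module.finrank ℝ V = d) (hd : 1 ≤ d)
    (hdn : d + 1 ≤ n) {x : Fin n → V} (hsum : ∑ i, x i = 0)
    (hx : ∀ σ : Equiv.Perm (Fin n), SubsetsIndependent (partialSum (x ∘ σ)) (n - 1) d) :
    {σ : Equiv.Perm (Fin n) | (0 : V) ∈ hullA (x ∘ σ)}.ncard = regionCountA n d := by
  rw [← (genericA_relations hV hdn hsum hx).numRegions_eq (by omega),
    numRegions_arrangementA_proj]
  congr 1
  ext σ
  constructor
  · intro h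
    obtain ⟨u, hu, h0⟩ := exists_strictAnti_of_zero_mem_hullA (hx σ) hdn hV h
    -- Subtracting the mean keeps the order of the entries and, because the increments sum to zero,
    -- keeps the relation.
    let c : ℝ := (∑ i, u i) / n
    refine ⟨fun p => u (σ.symm p) - c, ⟨mem_relations.2 ?_, ?_⟩, ?_⟩
    · simp only [sub_smul, Finset.sum_sub_distrib, ← Finset.smul_sum, hsum, smul_zero, sub_zero]
      rw [← h0, ← Equiv.sum_comp σ]
      simp
    · have hn : (n : ℝ) ≠ 0 := by
        simp
        omega
      change coordSum n _ = 0
      rw [coordSum_apply, Finset.sum_sub_distrib, Equiv.sum_comp σ.symm u]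
      simp only [Finset.sum_const, Finset.card_univ, Fintype.card_fin, nsmul_eq_mul, c]
      field_simp
      ring
    · intro i j hij
      simpa using hu hij
  · rintro ⟨v, hv, hu⟩
    refine zero_mem_hullA_of_strictAnti (by omega) ?_ hu ?_
    · rw [← hsum]
      exact Equiv.sum_comp σ x
    · rw [← mem_relations.1 hv.1]
      exact Equiv.sum_comp σ fun i => v i • x i

theorem sum_flipLast_smul (u : Fin n → ℝ) (y : Fin n → V) :
    ∑ i, flipLast u i • y i = ∑ i, u i • flipLast y i := by
  refine Finset.sum_congr rfl fun i _ => ?_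
  simp only [flipLast]
  split_ifs
  · rfl
  · rw [neg_smul, smul_neg]

theorem ncard_zero_mem_hullD [FiniteDimensional ℝ V] (hV : Module.finrank ℝ V = d)
    (hn : 2 ≤ n) (hdn : d ≤ n) {x : Fin n → V}
    (hx : ∀ g, SubsetsIndependent (partialSum (signedPerm g x)) n d) :
    {g : Equiv.Perm (Fin n) × (Fin n → ℤˣ) |
      ∏ i, g.2 i = 1 ∧ (0 : V) ∈ hullD (signedPerm g x)}.ncard = regionCountD n d := by
  rw [← (genericB_relations hV hdn hx).numRegions_arrangementD_eq hn,
    numRegions_arrangementD_proj (by omega)]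
  congr 1
  ext g
  refine and_congr_right fun _ => ?_
  rw [zero_mem_hullD_iff hn]
  constructor
  · have key : ∀ u, ChamberD u → ∑ i, u i • signedPerm g x i = 0 →
        ∃ v ∈ relations x, ChamberD (signedPerm g v) := by
      intro u hu h0
      obtain ⟨v, rfl⟩ := exists_signedPerm_eq g u
      exact ⟨v, mem_relations.2 (by rwa [sum_signedPerm_smul] at h0), hu⟩
    rintro (h | h)
    · obtain ⟨u, hu, h0⟩ := exists_chamberB_of_zero_mem_hullB (hx g) hdn hV h
      exact key u hu.chamberD h0
    · rw [← signedPerm_flipLast_signs] at h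
      obtain ⟨u, hu, h0⟩ := exists_chamberB_of_zero_mem_hullB (hx _) hdn hV h
      rw [signedPerm_flipLast_signs, ← sum_flipLast_smul] at h0
      exact key _ hu.chamberD.flipLast h0
  · rintro ⟨v, hv, hu⟩
    have h0 : ∑ i, signedPerm g v i • signedPerm g x i = 0 := by
      rw [sum_signedPerm_smul, mem_relations.1 hv]
    generalize signedPerm g x = y at h0 ⊢
    generalize signedPerm g v = u at hu h0
    have hn1 : n - 1 < n := by omega
    have hne : ∀ u : Fin n → ℝ, ChamberD u → ∃ i, u i ≠ 0 := by
      intro u hu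
      by_contra! hcon
      have := hu.2 ⟨0, by omega⟩ ⟨1, by omega⟩ (by simp [Fin.ext_iff])
      rw [hcon, hcon] at this
      linarith
    have hpos : ∀ u : Fin n → ℝ, ChamberD u → 0 ≤ u ⟨n - 1, hn1⟩ → ∀ i, 0 ≤ u i :=
      fun u hu hl i => hl.trans (hu.1.antitone (Fin.le_def.2 (by simp; omega)))
    -- The last entry is the smallest, so its sign decides whether `u` or its flip is a nonnegative
    -- decreasing vector.
    rcases le_total 0 (u ⟨n - 1, hn1⟩) with hl | hl
    · exact Or.inl (zero_mem_hullB_of_antitone hu.1.antitone (hpos u hu hl) (hne u hu) h0)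
    · refine Or.inr (zero_mem_hullB_of_antitone hu.flipLast.1.antitone
        (hpos _ hu.flipLast ?_) (hne _ hu.flipLast) ?_)
      · simp only [flipLast]
        rw [if_neg (by omega)]
        linarith
      · rw [sum_flipLast_smul, flipLast_flipLast, h0]

/-- General position of type `D` is the same as general position of type `B`. -/
theorem subsetsIndependent_of_starred (hn : 0 < n) {x : Fin n → V}
    (hx : ∀ g : Equiv.Perm (Fin n) × (Fin n → ℤˣ), ∏ i, g.2 i = 1 →
      SubsetsIndependent (partialSum (signedPerm g x)) n d ∧
      SubsetsIndependent (starredPartialSum (signedPerm g x)) n d)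
    (g : Equiv.Perm (Fin n) × (Fin n → ℤˣ)) :
    SubsetsIndependent (partialSum (signedPerm g x)) n d := by
  rcases Int.units_eq_one_or (∏ i, g.2 i) with hg | hg
  · exact (hx g hg).1
  · obtain ⟨σ, ε⟩ := g
    have h := (hx (σ, fun i => if (i : ℕ) + 1 < n then ε i else -ε i) (by
      simp only [prod_flipLast_signs hn, hg, neg_neg])).2
    rw [signedPerm_flipLast_signs] at h
    intro k hk hkn
    have := h k hk hkn
    simpa only [starredPartialSum_flipLast _ (hkn _).2] using this

end Counting

/-! ### Closed and open conditions on the hull; perturbation into general position -/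

section Semicontinuity

open Filter Topology

variable {V W κ : Type*} [NormedAddCommGroup V] [InnerProductSpace ℝ V]

theorem zero_notMem_convexHull_image_iff {t : Finset κ} {s : κ → V} :
    (0 : V) ∉ convexHull ℝ (s '' t) ↔ ∃ f : V →L[ℝ] ℝ, ∀ k ∈ t, 0 < f (s k) := by
  constructor
  · intro h
    obtain ⟨f, u, h0, hf⟩ := geometric_hahn_banach_point_closed (convex_convexHull ℝ _)
      (((t.finite_toSet.image s).isCompact_convexHull ℝ).isClosed) h
    rw [map_zero] at h0
    exact ⟨f, fun k hk => h0.trans (hf _ (subset_convexHull ℝ _ ⟨k, hk, rfl⟩))⟩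
  · rintro ⟨f, hf⟩ h
    obtain ⟨w, hw, ⟨k, hk, hwk⟩, h0⟩ := zero_mem_convexHull_image_iff.1 h
    have h1 : ∑ k ∈ t, w k * f (s k) = 0 := by simpa using congrArg f h0
    have h2 := Finset.sum_pos' (fun k hk => mul_nonneg (hw k hk) (hf k hk).le)
      ⟨k, hk, mul_pos hwk (hf k hk)⟩
    exact h2.ne' h1

/-- The complement is a union over functionals `f` of the open sets on which all `f (s k x)` are
positive. -/
theorem isClosed_zero_mem_convexHull [TopologicalSpace W]
    {t : Finset κ} {s : κ → W → V}
    (hs : ∀ k, Continuous (s k)) :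
    IsClosed {x | (0 : V) ∈ convexHull ℝ ((fun k => s k x) '' t)} := by
  rw [← isOpen_compl_iff]
  have : {x | (0 : V) ∈ convexHull ℝ ((fun k => s k x) '' t)}ᶜ =
      ⋃ f : V →L[ℝ] ℝ, ⋂ k ∈ t, {x | 0 < f (s k x)} := by
    ext x
    rw [Set.mem_compl_iff, Set.mem_ofPred_eq, zero_notMem_convexHull_image_iff]
    simp
  rw [this]
  exact isOpen_iUnion fun f => isOpen_biInter_finset fun k _ =>
    isOpen_lt continuous_const (f.continuous.comp (hs k))

/-- The points `x` such that no closed half-space bounded by a hyperplane through the origin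
contains all `s k x`. -/
def noHalfSpace (t : Finset κ) (s : κ → W → V) : Set W :=
  {x | ∀ y ∈ Metric.sphere (0 : V) 1, ∃ k ∈ t, inner ℝ y (s k x) < 0}

/-- The complement is the projection of a closed set along the unit sphere, which is compact. -/
theorem isOpen_noHalfSpace [TopologicalSpace W]
    [FiniteDimensional ℝ V] {t : Finset κ} {s : κ → W → V}
    (hs : ∀ k, Continuous (s k)) : IsOpen (noHalfSpace t s) := by
  rw [← isClosed_compl_iff]
  have : (noHalfSpace t s)ᶜ = Prod.snd ''
      ⋂ k ∈ t, {p : Metric.sphere (0 : V) 1 × W | 0 ≤ inner ℝ (p.1 : V) (s k p.2)} := by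
    ext x
    simp [noHalfSpace]
  rw [this]
  refine isClosedMap_snd_of_compactSpace _ (isClosed_biInter fun k _ => ?_)
  exact isClosed_le continuous_const
    ((continuous_subtype_val.comp continuous_fst).inner ((hs k).comp continuous_snd))

theorem noHalfSpace_of_zero_mem_interior {t : Finset κ} {s : κ → W → V} {x : W}
    (h : (0 : V) ∈ interior (convexHull ℝ ((fun k => s k x) '' t))) : x ∈ noHalfSpace t s := by
  intro y hy
  by_contra! hcon
  have hsub : convexHull ℝ ((fun k => s k x) '' t) ⊆ {v | 0 ≤ inner ℝ y v} := by
    refine convexHull_min ?_ ?_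
    · rintro _ ⟨k, hk, rfl⟩
      exact hcon k hk
    · intro v hv w hw a b ha hb _
      simp only [Set.mem_ofPred_eq, inner_add_right, inner_smul_right] at hv hw ⊢
      positivity
  have hc : Continuous fun ε : ℝ => -(ε • y) := by fun_prop
  have h1 : ∀ᶠ ε : ℝ in 𝓝 0, -(ε • y) ∈ convexHull ℝ ((fun k => s k x) '' t) :=
    hc.continuousAt.eventually (by simpa using mem_interior_iff_mem_nhds.1 h)
  obtain ⟨ε, hε, hpos⟩ := ((h1.filter_mono nhdsWithin_le_nhds).and
    (self_mem_nhdsWithin (s := Set.Ioi (0 : ℝ)))).exists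
  have h2 := hsub hε
  simp only [Set.mem_ofPred_eq, inner_neg_right, inner_smul_right, real_inner_self_eq_norm_sq,
    mem_sphere_zero_iff_norm.1 hy] at h2
  have : (0 : ℝ) < ε := hpos
  linarith

theorem zero_mem_convexHull_of_noHalfSpace [FiniteDimensional ℝ V] [Nontrivial V] {t : Finset κ}
    {s : κ → W → V} {x : W} (h : x ∈ noHalfSpace t s) :
    (0 : V) ∈ convexHull ℝ ((fun k => s k x) '' t) := by
  by_contra hcon
  obtain ⟨f, hf⟩ := zero_notMem_convexHull_image_iff.1 hcon
  -- Some unit vector is needed only to know that `t` is nonempty, so that the separating functional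
  -- is not zero and can be normalised.
  obtain ⟨y, hy⟩ := (NormedSpace.sphere_nonempty (x := (0 : V)) (r := 1)).2 zero_le_one
  obtain ⟨k, hk, -⟩ := h y hy
  set z := (InnerProductSpace.toDual ℝ V).symm f with hz
  have hzf : ∀ v, inner ℝ z v = f v := fun v => by simp [hz]
  have hz0 : z ≠ 0 := by
    intro e
    have := hzf (s k x)
    rw [e, inner_zero_left] at this
    exact (hf k hk).ne this
  obtain ⟨j, hj, hlt⟩ := h (‖z‖⁻¹ • z) (by simp [norm_smul, hz0])
  rw [real_inner_smul_left, hzf] at hlt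
  have := mul_pos (inv_pos.2 (norm_pos_iff.2 hz0)) (hf j hj)
  linarith

/-- Counting memberships in open and in closed sets along a convergent family. -/
theorem ncard_bounds_of_eventually [TopologicalSpace W] {γ τ : Type*} [Finite γ] {l : Filter τ} [l.NeBot]
    (p : γ → Prop) {O F : Set W} (hO : IsOpen O) (hF : IsClosed F) (hOF : O ⊆ F)
    {act : γ → W → W} (hact : ∀ g, Continuous (act g)) {N : ℕ} {x : W} {c : τ → W}
    (hc : Tendsto c l (𝓝 x)) (hN : ∀ᶠ t in l, {g | p g ∧ act g (c t) ∈ F}.ncard = N) :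
    {g | p g ∧ act g x ∈ O}.ncard ≤ N ∧ N ≤ {g | p g ∧ act g x ∈ F}.ncard := by
  have h1 : ∀ᶠ t in l, ∀ g, act g x ∈ O → act g (c t) ∈ O := by
    rw [eventually_all]
    intro g
    by_cases h : act g x ∈ O
    · filter_upwards [(((hact g).tendsto x).comp hc).eventually (hO.mem_nhds h)] with t ht _
      exact ht
    · exact Eventually.of_forall fun t h' => absurd h' h
  have h2 : ∀ᶠ t in l, ∀ g, act g (c t) ∈ F → act g x ∈ F := by
    rw [eventually_all]
    intro g
    by_cases h : act g x ∈ F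
    · exact Eventually.of_forall fun t _ => h
    · filter_upwards [(((hact g).tendsto x).comp hc).eventually
        (hF.isOpen_compl.mem_nhds h)] with t ht h'
      exact absurd h' ht
  obtain ⟨t, h1, h2, hN⟩ := (h1.and (h2.and hN)).exists
  rw [← hN]
  exact ⟨Set.ncard_le_ncard (fun g hg => ⟨hg.1, hOF (h1 g hg.2)⟩) (Set.toFinite _),
    Set.ncard_le_ncard (fun g hg => ⟨hg.1, h2 g hg.2⟩) (Set.toFinite _)⟩

/-- Moving along a line towards a linearly independent tuple. -/
theorem eventually_linearIndependent_add_smul [FiniteDimensional ℝ V] {d : ℕ}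
    (hV : Module.finrank ℝ V = d) (a : Fin d → V) {b : Fin d → V} (hb : LinearIndependent ℝ b) :
    ∀ᶠ t : ℝ in 𝓝[≠] 0, LinearIndependent ℝ fun j => a j + t • b j := by
  let B := basisOfLinearIndependentOfCardEqFinrank' b hb (by simp [hV])
  -- With `A b_j = a_j`, the perturbed tuple is `(A + t) b`. It is dependent only when `-t` is an
  -- eigenvalue of `A`, hence for finitely many `t`; the value `t = 0` may be among them and is
  -- punctured out.
  let A : V →ₗ[ℝ] V := B.constr ℝ a
  have hA : ∀ j, A (b j) = a j := fun j => by
    have := B.constr_basis ℝ a j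
    rwa [show B j = b j by simp [B]] at this
  have hfin : ((fun t : ℝ => -t) ⁻¹' spectrum ℝ A).Finite :=
    (Module.End.finite_spectrum A).preimage neg_injective.injOn
  have h1 : ∀ᶠ t : ℝ in 𝓝[≠] 0, t ∉ (fun t : ℝ => -t) ⁻¹' spectrum ℝ A := by
    have h2 : ((fun t : ℝ => -t) ⁻¹' spectrum ℝ A \ {0})ᶜ ∈ 𝓝 (0 : ℝ) :=
      (hfin.subset Set.sdiff_subset).isClosed.isOpen_compl.mem_nhds (by simp)
    filter_upwards [mem_nhdsWithin_of_mem_nhds h2, self_mem_nhdsWithin] with t ht ht0 hmem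
    exact ht ⟨hmem, ht0⟩
  filter_upwards [h1] with t ht
  have hu : IsUnit (algebraMap ℝ (Module.End ℝ V) (-t) - A) := by
    simpa [spectrum.mem_iff] using ht
  have hker := (Module.End.isUnit_iff _).1 hu
  have h3 := (hb.map' _ (LinearMap.ker_eq_bot.2 hker.injective)).neg
  have e : (fun j => a j + t • b j) = -⇑(algebraMap ℝ (Module.End ℝ V) (-t) - A) ∘ b := by
    funext j
    simp [hA, Module.algebraMap_end_apply]
  rw [e]
  exact h3

theorem SubsetsIndependent.eventually_add_smul [FiniteDimensional ℝ V] {d m : ℕ}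
    (hV : Module.finrank ℝ V = d) (a : ℕ → V) {b : ℕ → V} (hb : SubsetsIndependent b m d) :
    ∀ᶠ t : ℝ in 𝓝[≠] 0, SubsetsIndependent (fun k => a k + t • b k) m d := by
  have hfin : {k : Fin d → ℕ | ∀ j, k j ∈ Set.Icc 1 m}.Finite := by
    have := Set.Finite.pi' (fun _ : Fin d => Set.finite_Icc 1 m)
    exact this
  have : ∀ᶠ t : ℝ in 𝓝[≠] 0, ∀ k ∈ {k : Fin d → ℕ | ∀ j, k j ∈ Set.Icc 1 m},
      StrictMono k → LinearIndependent ℝ fun j => a (k j) + t • b (k j) := by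
    rw [hfin.eventually_all]
    intro k hk
    by_cases hmono : StrictMono k
    · filter_upwards [eventually_linearIndependent_add_smul hV (fun j => a (k j))
        (hb k hmono hk)] with t ht _
      exact ht
    · exact Eventually.of_forall fun t h => absurd h hmono
  filter_upwards [this] with t ht k hmono hk
  exact ht k hk hmono

end Semicontinuity

/-! ### Averaging over the group -/

section Averaging

open Filter Topology

variable {V W κ γ Ω Ω' : Type*} [MeasurableSpace Ω] [MeasurableSpace Ω'] [Finite γ]
  {p : γ → Prop}

/-- The count is a sum of indicators, one for each admissible `g`, and by invariance each has the
same expectation. -/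
theorem ncard_mul_measureReal_eq_integral [MeasurableSpace W] {P : Measure Ω}
    [IsProbabilityMeasure P] {act : γ → W → W} (hact : ∀ g, Measurable (act g)) {Y : Ω → W}
    (hY : Measurable Y) (hdist : ∀ g, p g → IdentDistrib Y (fun ω => act g (Y ω)) P P) {S : Set W}
    (hS : MeasurableSet S) :
    Integrable (fun ω => ({g | p g ∧ act g (Y ω) ∈ S}.ncard : ℝ)) P ∧
    ({g | p g}.ncard : ℝ) * P.real {ω | Y ω ∈ S} =
      ∫ ω, ({g | p g ∧ act g (Y ω) ∈ S}.ncard : ℝ) ∂P := by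
  classical
  have := Fintype.ofFinite γ
  have e : ∀ ω, ({g | p g ∧ act g (Y ω) ∈ S}.ncard : ℝ) =
      ∑ g ∈ Finset.univ.filter p, {ω | act g (Y ω) ∈ S}.indicator (fun _ => (1 : ℝ)) ω := by
    intro ω
    rw [show {g | p g ∧ act g (Y ω) ∈ S} =
      (((Finset.univ.filter p).filter fun g => act g (Y ω) ∈ S : Finset γ) : Set γ) by ext; simp,
      Set.ncard_coe_finset, Finset.card_filter]
    push_cast
    exact Finset.sum_congr rfl fun g _ => by simp [Set.indicator_apply]
  have hm : ∀ g, MeasurableSet {ω | act g (Y ω) ∈ S} := fun g => (hact g).comp hY hS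
  have hint : ∀ g ∈ Finset.univ.filter p,
      Integrable ({ω | act g (Y ω) ∈ S}.indicator fun _ => (1 : ℝ)) P :=
    fun g _ => (integrable_const _).indicator (hm g)
  simp only [e]
  refine ⟨integrable_finsetSum _ hint, ?_⟩
  rw [integral_finsetSum _ hint, show {g | p g} = ((Finset.univ.filter p : Finset γ) : Set γ) by
    ext; simp, Set.ncard_coe_finset, ← nsmul_eq_mul, ← Finset.sum_const]
  refine Finset.sum_congr rfl fun g hg => ?_
  rw [integral_indicator_const _ (hm g), smul_eq_mul, mul_one]
  exact congrArg ENNReal.toReal ((hdist g (Finset.mem_filter.1 hg).2).measure_mem_eq hS)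

theorem le_ncard_mul_measureReal [MeasurableSpace W] {P : Measure Ω}
    [IsProbabilityMeasure P] {act : γ → W → W} (hact : ∀ g, Measurable (act g)) {Y : Ω → W}
    (hY : Measurable Y) (hdist : ∀ g, p g → IdentDistrib Y (fun ω => act g (Y ω)) P P) {S : Set W}
    (hS : MeasurableSet S) {N : ℕ} (h : ∀ᵐ ω ∂P, N ≤ {g | p g ∧ act g (Y ω) ∈ S}.ncard) :
    (N : ℝ) ≤ ({g | p g}.ncard : ℝ) * P.real {ω | Y ω ∈ S} := by
  obtain ⟨hi, he⟩ := ncard_mul_measureReal_eq_integral hact hY hdist hS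
  rw [he]
  have := integral_mono_ae (integrable_const (μ := P) (N : ℝ)) hi
    (h.mono fun ω hω => Nat.cast_le.2 hω)
  simpa using this

theorem ncard_mul_measureReal_le [MeasurableSpace W] {P : Measure Ω}
    [IsProbabilityMeasure P] {act : γ → W → W} (hact : ∀ g, Measurable (act g)) {Y : Ω → W}
    (hY : Measurable Y) (hdist : ∀ g, p g → IdentDistrib Y (fun ω => act g (Y ω)) P P) {S : Set W}
    (hS : MeasurableSet S) {N : ℕ} (h : ∀ᵐ ω ∂P, {g | p g ∧ act g (Y ω) ∈ S}.ncard ≤ N) :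
    ({g | p g}.ncard : ℝ) * P.real {ω | Y ω ∈ S} ≤ N := by
  obtain ⟨hi, he⟩ := ncard_mul_measureReal_eq_integral hact hY hdist hS
  rw [he]
  have := integral_mono_ae hi (integrable_const (μ := P) (N : ℝ))
    (h.mono fun ω hω => Nat.cast_le.2 hω)
  simpa using this

/-- Comparison of absorption probabilities of two random tuples whose laws are invariant under
the same finite set of maps, when the number of these maps that lead to absorption is a constant
`N` in general position. -/
theorem absorption_probability_bounds [NormedAddCommGroup V] [InnerProductSpace ℝ V]
    [FiniteDimensional ℝ V] [Nontrivial V] [NormedAddCommGroup W] [NormedSpace ℝ W]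
    [MeasurableSpace W] [BorelSpace W] {P : Measure Ω} [IsProbabilityMeasure P] {P' : Measure Ω'}
    [IsProbabilityMeasure P'] {act : γ → W → W} (hact : ∀ g, Continuous (act g)) (hp : ∃ g, p g)
    {t : Finset κ} {s : κ → W → V} (hs : ∀ k, Continuous (s k)) {H : W → Set V}
    (hH : ∀ x, H x = convexHull ℝ ((fun k => s k x) '' t)) {U : Set W} {N : ℕ}
    (hU : ∀ x ∈ U, {g | p g ∧ (0 : V) ∈ H (act g x)}.ncard = N)
    {Y : Ω → W} (hY : Measurable Y)
    (hdist : ∀ g, p g → IdentDistrib Y (fun ω => act g (Y ω)) P P) (hYU : ∀ᵐ ω ∂P, Y ω ∈ U)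
    {Y' : Ω' → W} (hY' : Measurable Y')
    (hdist' : ∀ g, p g → IdentDistrib Y' (fun ω => act g (Y' ω)) P' P')
    (hYU' : ∀ᵐ ω ∂P', ∀ z ∈ U, ∀ᶠ ε : ℝ in 𝓝[≠] 0, Y' ω + ε • z ∈ U) :
    P'.real {ω | 0 ∈ interior (H (Y' ω))} ≤ P.real {ω | 0 ∈ H (Y ω)} ∧
    P.real {ω | 0 ∈ H (Y ω)} ≤ P'.real {ω | 0 ∈ H (Y' ω)} ∧
    P.real {ω | 0 ∈ H (Y ω)} = N / ({g | p g}.ncard : ℝ) := by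
  obtain rfl : H = fun x => convexHull ℝ ((fun k => s k x) '' t) := funext hH
  have hF := isClosed_zero_mem_convexHull (t := t) hs
  have hO := isOpen_noHalfSpace (t := t) hs
  set F := {x | (0 : V) ∈ convexHull ℝ ((fun k => s k x) '' t)} with hFdef
  have hOF : noHalfSpace t s ⊆ F := fun x hx => zero_mem_convexHull_of_noHalfSpace hx
  have hm : ∀ g, Measurable (act g) := fun g => (hact g).measurable
  have hG : (0 : ℝ) < ({g | p g}.ncard : ℝ) := by
    rw [Nat.cast_pos, Set.ncard_pos]
    exact hp
  have hval : P.real {ω | Y ω ∈ F} = N / ({g | p g}.ncard : ℝ) := by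
    rw [eq_div_iff hG.ne', mul_comm]
    exact le_antisymm
      (ncard_mul_measureReal_le hm hY hdist hF.measurableSet (hYU.mono fun ω h => (hU _ h).le))
      (le_ncard_mul_measureReal hm hY hdist hF.measurableSet (hYU.mono fun ω h => (hU _ h).ge))
  -- A sample of the first tuple supplies the generic direction for perturbing the second one;
  -- almost sure membership in `U` guarantees that one exists.
  obtain ⟨ω₀, hω₀⟩ := hYU.exists
  have hbounds : ∀ᵐ ω ∂P', {g | p g ∧ act g (Y' ω) ∈ noHalfSpace t s}.ncard ≤ N ∧
      N ≤ {g | p g ∧ act g (Y' ω) ∈ F}.ncard := by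
    filter_upwards [hYU'] with ω hω
    refine ncard_bounds_of_eventually p hO hF hOF hact (c := fun ε : ℝ => Y' ω + ε • Y ω₀)
      (l := 𝓝[≠] 0) ?_ ((hω _ hω₀).mono fun ε hε => hU _ hε)
    have hc : Continuous fun ε : ℝ => Y' ω + ε • Y ω₀ := by fun_prop
    have := hc.tendsto 0
    rw [zero_smul, add_zero] at this
    exact this.mono_left nhdsWithin_le_nhds
  refine ⟨?_, ?_, hval⟩
  · change _ ≤ P.real {ω | Y ω ∈ F}
    rw [hval, le_div_iff₀ hG, mul_comm]
    have hsub : {ω | 0 ∈ interior (convexHull ℝ ((fun k => s k (Y' ω)) '' t))} ⊆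
        {ω | Y' ω ∈ noHalfSpace t s} := fun ω hω => noHalfSpace_of_zero_mem_interior hω
    refine le_trans (mul_le_mul_of_nonneg_left (measureReal_mono hsub) hG.le) (ncard_mul_measureReal_le hm hY' hdist'
        hO.measurableSet (hbounds.mono fun ω h => h.1))
  · change P.real {ω | Y ω ∈ F} ≤ P'.real {ω | Y' ω ∈ F}
    rw [hval, div_le_iff₀ hG, mul_comm]
    exact le_ncard_mul_measureReal hm hY' hdist' hF.measurableSet (hbounds.mono fun ω h => h.2)

end Averaging

/-! ### The three settings -/

section Main

open Filter Topology

variable {n d : ℕ}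

theorem partialSum_add_smul {V : Type*} [AddCommGroup V] [Module ℝ V] (x z : Fin n → V) (t : ℝ)
    (k : ℕ) : partialSum (x + t • z) k = partialSum x k + t • partialSum z k := by
  simp only [partialSum, Finset.smul_sum, ← Finset.sum_add_distrib]
  refine Finset.sum_congr rfl fun i _ => ?_
  split_ifs <;> simp

theorem signedPerm_add_smul {V : Type*} [AddCommGroup V] [Module ℝ V]
    (g : Equiv.Perm (Fin n) × (Fin n → ℤˣ)) (x z : Fin n → V) (t : ℝ) :
    signedPerm g (x + t • z) = signedPerm g x + t • signedPerm g z := by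
  funext i
  rcases Int.units_eq_one_or (g.2 i) with h | h <;>
    simp [signedPerm, h, Units.smul_def]

theorem continuous_partialSum {V : Type*} [AddCommGroup V] [TopologicalSpace V]
    [IsTopologicalAddGroup V] (k : ℕ) : Continuous fun x : Fin n → V => partialSum x k := by
  refine continuous_finsetSum _ fun i _ => ?_
  split_ifs
  · exact continuous_apply i
  · exact continuous_const

theorem continuous_starSum {V : Type*} [AddCommGroup V] [TopologicalSpace V]
    [IsTopologicalAddGroup V] : Continuous fun x : Fin n → V => starSum x := by
  refine continuous_finsetSum _ fun i _ => ?_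
  split_ifs
  · exact continuous_apply i
  · exact (continuous_apply i).neg

theorem continuous_starredPartialSum {V : Type*} [AddCommGroup V] [TopologicalSpace V]
    [IsTopologicalAddGroup V] (k : ℕ) : Continuous fun x : Fin n → V => starredPartialSum x k := by
  unfold starredPartialSum
  split_ifs
  · exact continuous_partialSum k
  · exact continuous_starSum

theorem continuous_signedPerm {V : Type*} [AddCommGroup V] [TopologicalSpace V]
    [IsTopologicalAddGroup V] (g : Equiv.Perm (Fin n) × (Fin n → ℤˣ)) :
    Continuous fun x : Fin n → V => signedPerm g x := by
  refine continuous_pi fun i => ?_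
  rcases Int.units_eq_one_or (g.2 i) with h | h
  · simp only [signedPerm, h, one_smul]
    exact continuous_apply _
  · simp only [signedPerm, h, Units.smul_def, Units.val_neg, Units.val_one, neg_smul, one_smul]
    exact (continuous_apply _).neg

/-- General position passes to tuples with the same law. -/
theorem ae_subsetsIndependent_of_identDistrib {V W Ω : Type*} [MeasurableSpace Ω]
    [NormedAddCommGroup V] [NormedSpace ℝ V] [TopologicalSpace W] [MeasurableSpace W]
    [OpensMeasurableSpace W] {P : Measure Ω} {m : ℕ} {s : ℕ → W → V} (hs : ∀ k, Continuous (s k))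
    {Y Z : Ω → W} (hYZ : IdentDistrib Y Z P P)
    (h : ∀ k : Fin d → ℕ, StrictMono k → (∀ j, 1 ≤ k j ∧ k j ≤ m) →
      ∀ᵐ ω ∂P, LinearIndependent ℝ fun j => s (k j) (Y ω)) :
    ∀ᵐ ω ∂P, SubsetsIndependent (fun k => s k (Z ω)) m d := by
  unfold SubsetsIndependent
  rw [ae_all_iff]
  intro k
  simp only [eventually_imp_distrib_left]
  intro hk hkm
  have ho : IsOpen {x : W | LinearIndependent ℝ fun j => s (k j) x} :=
    isOpen_setOfPred_linearIndependent.preimage (continuous_pi fun j => hs (k j))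
  exact hYZ.ae_snd ho.measurableSet (h k hk hkm)

/-- Flipping the last sign is an involution that exchanges even and odd sign patterns. -/
theorem ncard_even_signedPerm (hn : 0 < n) :
    2 * {g : Equiv.Perm (Fin n) × (Fin n → ℤˣ) | ∏ i, g.2 i = 1}.ncard =
      2 ^ n * n.factorial := by
  let f : Equiv.Perm (Fin n) × (Fin n → ℤˣ) → Equiv.Perm (Fin n) × (Fin n → ℤˣ) :=
    fun g => (g.1, fun i => if (i : ℕ) + 1 < n then g.2 i else -g.2 i)
  have hf : Function.Involutive f := by
    rintro ⟨σ, ε⟩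
    simp only [f, Prod.mk.injEq, true_and]
    funext i
    split_ifs <;> simp
  have hprod : ∀ g, ∏ i, (f g).2 i = -∏ i, g.2 i := fun g => prod_flipLast_signs hn g.2
  have hcompl : {g : Equiv.Perm (Fin n) × (Fin n → ℤˣ) | ∏ i, g.2 i = 1}ᶜ =
      f '' {g | ∏ i, g.2 i = 1} := by
    ext g
    rw [hf.image_eq_preimage_symm]
    simp only [Set.mem_compl_iff, Set.mem_ofPred_eq, Set.mem_preimage, hprod]
    rcases Int.units_eq_one_or (∏ i, g.2 i) with h | h <;> rw [h] <;> decide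
  have h1 := Set.ncard_add_ncard_compl
    {g : Equiv.Perm (Fin n) × (Fin n → ℤˣ) | ∏ i, g.2 i = 1}
  rw [hcompl, Set.ncard_image_of_injective _ hf.injective, ← two_mul, Nat.card_prod,
    Nat.card_eq_fintype_card, Nat.card_eq_fintype_card, Fintype.card_perm, Fintype.card_fin] at h1
  rw [h1]
  simp [mul_comm]

theorem regionCountA_div (n d : ℕ) :
    (regionCountA n d : ℝ) / (n.factorial : ℝ) = valueA n d := by
  unfold regionCountA valueA
  push_cast
  ring

theorem regionCountB_div (n d : ℕ) :
    (regionCountB n d : ℝ) / (2 ^ n * (n.factorial : ℝ)) = valueB n d := by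
  unfold regionCountB valueB
  push_cast
  ring

theorem regionCountD_div (n d : ℕ) :
    (regionCountD n d : ℝ) / (2 ^ (n - 1) * (n.factorial : ℝ)) = valueD n d := by
  unfold regionCountD valueD
  push_cast
  ring

variable {Ω Ω' : Type*} [MeasurableSpace Ω] [MeasurableSpace Ω'] {P : Measure Ω}
  [IsProbabilityMeasure P] {P' : Measure Ω'} [IsProbabilityMeasure P']
  {ξ : Fin n → Ω → EuclideanSpace ℝ (Fin d)} {ξ' : Fin n → Ω' → EuclideanSpace ℝ (Fin d)}

theorem absorption_typeA (hd : 1 ≤ d) (hξ : SettingA P ξ) (hgen : GenPosA P ξ)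
    (hξ' : SettingA P' ξ') :
    P'.real {ω | 0 ∈ interior (hullA fun i => ξ' i ω)} ≤ P.real {ω | 0 ∈ hullA fun i => ξ i ω} ∧
    P.real {ω | 0 ∈ hullA fun i => ξ i ω} ≤ P'.real {ω | 0 ∈ hullA fun i => ξ' i ω} ∧
    P.real {ω | 0 ∈ hullA fun i => ξ i ω} = valueA n d := by
  have hV : Module.finrank ℝ (EuclideanSpace ℝ (Fin d)) = d := by simp
  have : Nontrivial (EuclideanSpace ℝ (Fin d)) :=
    Module.nontrivial_of_finrank_pos (R := ℝ) (by omega)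
  have hact : ∀ σ : Equiv.Perm (Fin n),
      Continuous fun x : Fin n → EuclideanSpace ℝ (Fin d) => x ∘ σ :=
    fun σ => continuous_pi fun i => continuous_apply (σ i)
  have hcard : ({σ : Equiv.Perm (Fin n) | True}.ncard : ℝ) = n.factorial := by
    simp [Set.ncard_univ, Fintype.card_perm]
  rw [← regionCountA_div, ← hcard]
  refine absorption_probability_bounds (p := fun _ : Equiv.Perm (Fin n) => True)
    (Y := fun ω i => ξ i ω) (Y' := fun ω i => ξ' i ω) hact ⟨1, trivial⟩
    (fun k => continuous_partialSum k) hullA_eq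
    (U := {x | ∑ i, x i = 0 ∧ ∀ σ : Equiv.Perm (Fin n),
      SubsetsIndependent (partialSum (x ∘ σ)) (n - 1) d}) ?_
    (measurable_pi_lambda _ hξ.measurable) (fun σ _ => hξ.exchangeable σ) ?_
    (measurable_pi_lambda _ hξ'.measurable) (fun σ _ => hξ'.exchangeable σ) ?_
  · rintro x ⟨hsum, hx⟩
    simpa only [true_and] using ncard_zero_mem_hullA hV hd hξ.le hsum hx
  · refine hξ.bridge.and (ae_all_iff.2 fun σ => ?_)
    refine ae_subsetsIndependent_of_identDistrib (s := fun k x => partialSum x k)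
      continuous_partialSum (hξ.exchangeable σ) fun k hk hkm => hgen k hk fun j => ?_
    have := hkm j
    have := hξ.le
    omega
  · filter_upwards [hξ'.bridge] with ω hω z hz
    have h1 : ∀ᶠ ε : ℝ in 𝓝[≠] 0, ∀ σ : Equiv.Perm (Fin n), SubsetsIndependent
        (partialSum (((fun i => ξ' i ω) + ε • z) ∘ σ)) (n - 1) d := by
      rw [eventually_all]
      intro σ
      filter_upwards [(hz.2 σ).eventually_add_smul hV
        (partialSum ((fun i => ξ' i ω) ∘ σ))] with ε hε
      rw [show ((fun i => ξ' i ω) + ε • z) ∘ σ = (fun i => ξ' i ω) ∘ σ + ε • (z ∘ σ) from rfl,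
        funext fun k => partialSum_add_smul ((fun i => ξ' i ω) ∘ σ) (z ∘ σ) ε k]
      exact hε
    filter_upwards [h1] with ε hε
    refine ⟨?_, hε⟩
    simp only [Pi.add_apply, Pi.smul_apply, Finset.sum_add_distrib, ← Finset.smul_sum, hω, hz.1,
      smul_zero, add_zero]

theorem eventually_subsetsIndependent_signedPerm {V : Type*} [NormedAddCommGroup V]
    [InnerProductSpace ℝ V] [FiniteDimensional ℝ V] (hV : Module.finrank ℝ V = d)
    (x : Fin n → V) {z : Fin n → V}
    (hz : ∀ g, SubsetsIndependent (partialSum (signedPerm g z)) n d) :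
    ∀ᶠ ε : ℝ in 𝓝[≠] 0, ∀ g, SubsetsIndependent (partialSum (signedPerm g (x + ε • z))) n d := by
  rw [eventually_all]
  intro g
  filter_upwards [(hz g).eventually_add_smul hV (partialSum (signedPerm g x))] with ε hε
  rw [signedPerm_add_smul,
    funext fun k => partialSum_add_smul (signedPerm g x) (signedPerm g z) ε k]
  exact hε

theorem absorption_typeB (hd : 1 ≤ d) (hξ : SettingB P ξ) (hgen : GenPosB P ξ)
    (hξ' : SettingB P' ξ') :
    P'.real {ω | 0 ∈ interior (hullB fun i => ξ' i ω)} ≤ P.real {ω | 0 ∈ hullB fun i => ξ i ω} ∧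
    P.real {ω | 0 ∈ hullB fun i => ξ i ω} ≤ P'.real {ω | 0 ∈ hullB fun i => ξ' i ω} ∧
    P.real {ω | 0 ∈ hullB fun i => ξ i ω} = valueB n d := by
  have hV : Module.finrank ℝ (EuclideanSpace ℝ (Fin d)) = d := by simp
  have : Nontrivial (EuclideanSpace ℝ (Fin d)) :=
    Module.nontrivial_of_finrank_pos (R := ℝ) (by omega)
  have hcard : ({g : Equiv.Perm (Fin n) × (Fin n → ℤˣ) | True}.ncard : ℝ) =
      2 ^ n * n.factorial := by
    simp [Set.ncard_univ, Fintype.card_perm, mul_comm]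
  rw [← regionCountB_div, ← hcard]
  refine absorption_probability_bounds
    (p := fun _ : Equiv.Perm (Fin n) × (Fin n → ℤˣ) => True)
    (Y := fun ω i => ξ i ω) (Y' := fun ω i => ξ' i ω) continuous_signedPerm ⟨1, trivial⟩
    (fun k => continuous_partialSum k) hullB_eq
    (U := {x | ∀ g, SubsetsIndependent (partialSum (signedPerm g x)) n d}) ?_
    (measurable_pi_lambda _ hξ.measurable) (fun g _ => hξ.symmetric g.1 g.2) ?_
    (measurable_pi_lambda _ hξ'.measurable) (fun g _ => hξ'.symmetric g.1 g.2) ?_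
  · intro x hx
    simpa only [true_and] using ncard_zero_mem_hullB hV hd hξ.le hx
  · exact ae_all_iff.2 fun g => ae_subsetsIndependent_of_identDistrib
      (s := fun k x => partialSum x k) continuous_partialSum (hξ.symmetric g.1 g.2) hgen
  · exact Eventually.of_forall fun ω z hz => eventually_subsetsIndependent_signedPerm hV _ hz

theorem absorption_typeD (hd : 1 ≤ d) (hξ : SettingD P ξ) (hgen : GenPosD P ξ)
    (hξ' : SettingD P' ξ') :
    P'.real {ω | 0 ∈ interior (hullD fun i => ξ' i ω)} ≤ P.real {ω | 0 ∈ hullD fun i => ξ i ω} ∧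
    P.real {ω | 0 ∈ hullD fun i => ξ i ω} ≤ P'.real {ω | 0 ∈ hullD fun i => ξ' i ω} ∧
    P.real {ω | 0 ∈ hullD fun i => ξ i ω} = valueD n d := by
  have hV : Module.finrank ℝ (EuclideanSpace ℝ (Fin d)) = d := by simp
  have : Nontrivial (EuclideanSpace ℝ (Fin d)) :=
    Module.nontrivial_of_finrank_pos (R := ℝ) (by omega)
  obtain ⟨hn, hdn⟩ := max_le_iff.1 hξ.le
  have hcard : ({g : Equiv.Perm (Fin n) × (Fin n → ℤˣ) | ∏ i, g.2 i = 1}.ncard : ℝ) =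
      2 ^ (n - 1) * n.factorial := by
    have h1 := ncard_even_signedPerm (n := n) (by omega)
    have h2 : 2 ^ n = 2 * 2 ^ (n - 1) := by rw [← pow_succ', Nat.sub_add_cancel (by omega)]
    rw [h2, mul_assoc] at h1
    exact_mod_cast Nat.eq_of_mul_eq_mul_left two_pos h1
  rw [← regionCountD_div, ← hcard]
  refine absorption_probability_bounds
    (p := fun g : Equiv.Perm (Fin n) × (Fin n → ℤˣ) => ∏ i, g.2 i = 1)
    (Y := fun ω i => ξ i ω) (Y' := fun ω i => ξ' i ω) continuous_signedPerm ⟨1, by simp⟩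
    (fun k => ?_) hullD_eq
    (U := {x | ∀ g, SubsetsIndependent (partialSum (signedPerm g x)) n d}) ?_
    (measurable_pi_lambda _ hξ.measurable) (fun g hg => hξ.symmetric g.1 g.2 hg) ?_
    (measurable_pi_lambda _ hξ'.measurable) (fun g hg => hξ'.symmetric g.1 g.2 hg) ?_
  · split_ifs
    · exact continuous_partialSum k
    · exact continuous_starSum
  · exact fun x hx => ncard_zero_mem_hullD hV hn hdn hx
  · have h : ∀ᵐ ω ∂P, ∀ g : Equiv.Perm (Fin n) × (Fin n → ℤˣ), ∏ i, g.2 i = 1 →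
        SubsetsIndependent (partialSum (signedPerm g fun i => ξ i ω)) n d ∧
        SubsetsIndependent (starredPartialSum (signedPerm g fun i => ξ i ω)) n d := by
      rw [ae_all_iff]
      intro g
      rw [eventually_imp_distrib_left]
      intro hg
      have hdist := hξ.symmetric g.1 g.2 hg
      exact (ae_subsetsIndependent_of_identDistrib (s := fun k x => partialSum x k)
        continuous_partialSum hdist fun k hk hkn => (hgen k hk hkn).1).and
        (ae_subsetsIndependent_of_identDistrib (s := fun k x => starredPartialSum x k)
        continuous_starredPartialSum hdist fun k hk hkn => (hgen k hk hkn).2)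
    exact h.mono fun ω hω => subsetsIndependent_of_starred (by omega) hω
  · exact Eventually.of_forall fun ω z hz => eventually_subsetsIndependent_signedPerm hV _ hz

end Main

theorem proposition2p8 {n d : ℕ} (hd : 1 ≤ d)
    {Ω : Type*} [MeasurableSpace Ω] (P : Measure Ω) [IsProbabilityMeasure P]
    {Ω' : Type*} [MeasurableSpace Ω'] (P' : Measure Ω') [IsProbabilityMeasure P']
    (ξ : Fin n → Ω → EuclideanSpace ℝ (Fin d))
    (ξ' : Fin n → Ω' → EuclideanSpace ℝ (Fin d)) :
    (SettingA P ξ → GenPosA P ξ → SettingA P' ξ' →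
      P'.real {ω | 0 ∈ interior (hullA fun i => ξ' i ω)} ≤ P.real {ω | 0 ∈ hullA fun i => ξ i ω} ∧
      P.real {ω | 0 ∈ hullA fun i => ξ i ω} ≤ P'.real {ω | 0 ∈ hullA fun i => ξ' i ω} ∧
      P.real {ω | 0 ∈ hullA fun i => ξ i ω} = valueA n d) ∧
    (SettingB P ξ → GenPosB P ξ → SettingB P' ξ' →
      P'.real {ω | 0 ∈ interior (hullB fun i => ξ' i ω)} ≤ P.real {ω | 0 ∈ hullB fun i => ξ i ω} ∧
      P.real {ω | 0 ∈ hullB fun i => ξ i ω} ≤ P'.real {ω | 0 ∈ hullB fun i => ξ' i ω} ∧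
      P.real {ω | 0 ∈ hullB fun i => ξ i ω} = valueB n d) ∧
    (SettingD P ξ → GenPosD P ξ → SettingD P' ξ' →
      P'.real {ω | 0 ∈ interior (hullD fun i => ξ' i ω)} ≤ P.real {ω | 0 ∈ hullD fun i => ξ i ω} ∧
      P.real {ω | 0 ∈ hullD fun i => ξ i ω} ≤ P'.real {ω | 0 ∈ hullD fun i => ξ' i ω} ∧
      P.real {ω | 0 ∈ hullD fun i => ξ i ω} = valueD n d) :=
  ⟨absorption_typeA hd, absorption_typeB hd, absorption_typeD hd⟩
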